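/- **Setting.** A *partial graph* has finite sets of vertices and edges, and each edge has at most two endpoints (incident vertices). A path $(v_0,e_1,v_1,\dots,e_n,v_n)$ is such that the endpoints of each $e_i$ are exactly the two distinct vertices $v_{i-1},v_i$; it is simple if its edges are pairwise distinct and its vertices are pairwise distinct, except that possibly $v_0=v_n$; a cycle is a simple path with $n\ge 1$ and $v_0=v_n$. Two vertices are connected if some path joins them, an edge is connected to the elements connected to one of its endpoints, and to itself; the classes for this relation on vertices and edges are the connected components. A *proof structure* (of unit-free multiplicative linear logic) is a finite directed acyclic partial graph (source and target of an edge may each be undefined) whose vertices are labeled $ax$, $cut$, $\otimes$ or $⅋$ and whose edges are labeled with localized formulas (formulas over atoms $X,X^\perp$ and the connectives $\otimes,⅋$, each of whose syntactic constructs carries a tag from a countably infinite set, no tag being repeated in a formula). The premises (conclusions) of a vertex are the edges with target (source) this vertex. An $ax$-vertex has no premise and exactly two conclusions, of dual types; a $cut$-vertex has exactly two premises, of dual types, and no conclusion; a $\otimes$-vertex (resp. $⅋$-vertex) has exactly two premises, of types $A$ and $B$, and exactly one conclusion, of type $A\otimes B$ (resp. $A⅋B$). The tag sets of distinct initial edges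 (edges without source, or with source an $ax$-vertex) are disjoint. Paths in a proof structure ignore orientation. A *proof net* is a proof structure in which every cycle contains both premises of some $⅋$-vertex. A *correctness graph* is obtained by making undefined, for each $⅋$-vertex, the target of one of its two premises. A proof net is *DR-connected* if each of its correctness graphs has exactly one connected component. A *proper cycle* of a $⅋$-vertex $v$ is a cycle with source and target $v$ whose first and last edges are the two premises of $v$ and which does not pass consecutively through an edge $e$, a $⅋$-vertex $w$ and an edge $f$ with $e,f$ the two premises of $w$ at any internal position. A proof net is *almost connected* if it has at least one vertex or edge and every $⅋$-vertex has a proper cycle. **Corollary (Decomposition of almost connected proof nets).** Every almost connected proof net is (isomorphic to) the disjoint union of a finite non-empty family of DR-connected proof nets. -/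

import Mathlib

universe u v w

namespace ProofNets

/-! ### Formulas of unit-free multiplicative linear logic -/

/-- Formulas of unit-free multiplicative linear logic over a set of atoms. -/
inductive Formula (Atom : Type w) : Type w
  | atom (X : Atom)
  | natom (X : Atom)
  | tensor (A B : Formula Atom)
  | par (A B : Formula Atom)

/-- The De Morgan dual of a formula. -/
def Formula.dual {Atom : Type w} : Formula Atom → Formula Atom
  | .atom X => .natom X
  | .natom X => .atom X
  | .tensor A B => .par A.dual B.dual
  | .par A B => .tensor A.dual B.dual

/-- Formulas in which every syntactic construct carries a tag, taken in `ℕ`. -/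
inductive TaggedFormula (Atom : Type w) : Type w
  | atom (l : ℕ) (X : Atom)
  | natom (l : ℕ) (X : Atom)
  | tensor (l : ℕ) (A B : TaggedFormula Atom)
  | par (l : ℕ) (A B : TaggedFormula Atom)

namespace TaggedFormula

variable {Atom : Type w}

/-- The formula obtained by forgetting the tags. -/
def underlying : TaggedFormula Atom → Formula Atom
  | .atom _ X => .atom X
  | .natom _ X => .natom X
  | .tensor _ A B => .tensor A.underlying B.underlying
  | .par _ A B => .par A.underlying B.underlying

/-- The locations (tags) of a tagged formula, with repetitions. -/
def locations : TaggedFormula Atom → List ℕ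
  | .atom l _ => [l]
  | .natom l _ => [l]
  | .tensor l A B => l :: (A.locations ++ B.locations)
  | .par l A B => l :: (A.locations ++ B.locations)

/-- A localized formula is a tagged formula in which no location is used twice. -/
def IsLocalized (A : TaggedFormula Atom) : Prop := A.locations.Nodup

/-- Two localized formulas are dual when their underlying formulas are. -/
def AreDual (A B : TaggedFormula Atom) : Prop := B.underlying = A.underlying.dual

end TaggedFormula

/-! ### Partial graphs, paths, connectedness -/

/-- A partial multigraph: each edge has a set of at most two endpoints. -/
structure PartialGraph (V : Type u) (E : Type v) where
  inc : E → Set V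
  encard_inc_le : ∀ e, (inc e).encard ≤ 2

namespace PartialGraph

variable {V : Type u} {E : Type v} (G : PartialGraph V E)

/-- The endpoints of `e` are exactly the two distinct vertices `x` and `y`. -/
def Joins (e : E) (x y : V) : Prop := x ≠ y ∧ G.inc e = {x, y}

/-- Paths `(v₀, e₁, v₁, …, eₙ, vₙ)`, indexed by their source and target. -/
inductive Path : V → V → Type (max u v)
  | nil (x : V) : Path x x
  | cons {x y z : V} (e : E) (h : G.Joins e x y) (p : Path y z) : Path x z

namespace Path

variable {G}

/-- The list `e₁, …, eₙ` of the edges of a path. -/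
def edges : ∀ {x y : V}, G.Path x y → List E
  | _, _, .nil _ => []
  | _, _, .cons e _ p => e :: p.edges

/-- The list `v₀, …, vₙ` of the vertices of a path. -/
def support : ∀ {x y : V}, G.Path x y → List V
  | _, _, .nil x => [x]
  | x, _, .cons _ _ p => x :: p.support

/-- The list of the consecutive triples `(eᵢ, vᵢ, eᵢ₊₁)` of a path, for `1 ≤ i < n`. -/
def turns {x y : V} (p : G.Path x y) : List (E × V × E) :=
  p.edges.zip (p.support.tail.zip p.edges.tail)

/-- A path is simple if its edges are pairwise distinct, and its vertices `v₀, …, vₙ` are pairwise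
distinct except that possibly `v₀ = vₙ`. -/
def IsSimple {x y : V} (p : G.Path x y) : Prop :=
  p.edges.Nodup ∧ p.support.tail.Nodup ∧ p.support.dropLast.Nodup

/-- A cycle is a non-empty simple closed path. -/
def IsCycle {x : V} (p : G.Path x x) : Prop := p.edges ≠ [] ∧ p.IsSimple

end Path

/-- Two vertices are linked when some path has them as endpoints. -/
def VLinked (x y : V) : Prop := Nonempty (G.Path x y)

/-- The connectedness relation between the vertices and edges of a partial graph. -/
def Linked : V ⊕ E → V ⊕ E → Prop
  | .inl x, .inl y => G.VLinked x y
  | .inl x, .inr f => ∃ y ∈ G.inc f, G.VLinked x y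
  | .inr e, .inl y => ∃ x ∈ G.inc e, G.VLinked x y
  | .inr e, .inr f => e = f ∨ ∃ x ∈ G.inc e, ∃ y ∈ G.inc f, G.VLinked x y

theorem VLinked.refl (x : V) : G.VLinked x x := ⟨.nil x⟩

variable {G}

theorem VLinked.trans {x y z : V} (h : G.VLinked x y) (k : G.VLinked y z) : G.VLinked x z := by
  obtain ⟨p⟩ := h
  induction p with
  | nil x => exact k
  | cons e h p ih =>
    obtain ⟨q⟩ := ih k
    exact ⟨.cons e h q⟩

theorem VLinked.symm {x y : V} (h : G.VLinked x y) : G.VLinked y x := by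
  obtain ⟨p⟩ := h
  induction p with
  | nil x => exact ⟨.nil x⟩
  | cons e h p ih =>
    exact ih.trans ⟨.cons e ⟨h.1.symm, by rw [h.2, Set.pair_comm]⟩ (.nil _)⟩

theorem VLinked.of_mem_inc {e : E} {x y : V} (hx : x ∈ G.inc e) (hy : y ∈ G.inc e) :
    G.VLinked x y := by
  by_cases h : x = y
  · exact h ▸ VLinked.refl G x
  · have hs : ({x, y} : Set V) ⊆ G.inc e := Set.pair_subset hx hy
    have hc : (G.inc e).encard ≤ ({x, y} : Set V).encard := by
      rw [Set.encard_pair h]; exact G.encard_inc_le e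
    have he := Set.Finite.eq_of_subset_of_encard_le (Set.toFinite ({x, y} : Set V)) hs hc
    exact ⟨.cons e ⟨h, he.symm⟩ (.nil y)⟩

variable (G)

theorem linked_equivalence : Equivalence G.Linked where
  refl := by
    rintro (x | e)
    · exact VLinked.refl G x
    · exact Or.inl rfl
  symm := by
    rintro (x | e) (y | f) h
    · exact VLinked.symm h
    · obtain ⟨y, hy, h⟩ := h
      exact ⟨y, hy, h.symm⟩
    · obtain ⟨y, hy, h⟩ := h
      exact ⟨y, hy, h.symm⟩
    · rcases h with h | ⟨x, hx, y, hy, h⟩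
      · exact Or.inl h.symm
      · exact Or.inr ⟨y, hy, x, hx, h.symm⟩
  trans := by
    rintro (x | e) (y | f) (z | g) h k
    · exact VLinked.trans h k
    · obtain ⟨z, hz, k⟩ := k
      exact ⟨z, hz, VLinked.trans h k⟩
    · obtain ⟨y, hy, h⟩ := h
      obtain ⟨y', hy', k⟩ := k
      exact h.trans ((VLinked.of_mem_inc hy hy').trans k)
    · obtain ⟨y, hy, h⟩ := h
      rcases k with rfl | ⟨y', hy', z, hz, k⟩
      · exact ⟨y, hy, h⟩
      · exact ⟨z, hz, h.trans ((VLinked.of_mem_inc hy hy').trans k)⟩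
    · obtain ⟨x, hx, h⟩ := h
      exact ⟨x, hx, VLinked.trans h k⟩
    · obtain ⟨x, hx, h⟩ := h
      obtain ⟨z, hz, k⟩ := k
      exact Or.inr ⟨x, hx, z, hz, h.trans k⟩
    · obtain ⟨y', hy', k⟩ := k
      rcases h with rfl | ⟨x, hx, y, hy, h⟩
      · exact ⟨y', hy', k⟩
      · exact ⟨x, hx, h.trans ((VLinked.of_mem_inc hy hy').trans k)⟩
    · rcases h with rfl | ⟨x, hx, y, hy, h⟩
      · exact k
      · rcases k with rfl | ⟨y', hy', z, hz, k⟩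
        · exact Or.inr ⟨x, hx, y, hy, h⟩
        · exact Or.inr ⟨x, hx, z, hz, h.trans ((VLinked.of_mem_inc hy hy').trans k)⟩

/-- Vertices and edges up to connectedness: the classes are the connected components. -/
def linkedSetoid : Setoid (V ⊕ E) := ⟨G.Linked, G.linked_equivalence⟩

/-- The number of connected components of a (finite) partial graph. -/
noncomputable def numComponents : ℕ := Nat.card (Quotient G.linkedSetoid)

end PartialGraph

/-! ### Directed partial graphs -/

/-- A directed partial graph: sources and targets of edges may be undefined. -/
structure DirectedPartialGraph (V : Type u) (E : Type v) where
  src : E → Option V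
  tgt : E → Option V

namespace DirectedPartialGraph

variable {V : Type u} {E : Type v} (G : DirectedPartialGraph V E)

/-- The underlying (undirected) partial graph. -/
def toPartialGraph : PartialGraph V E where
  inc e := {x | G.src e = some x ∨ G.tgt e = some x}
  encard_inc_le e := by
    have h1 : ∀ o : Option V, {x | o = some x}.encard ≤ 1 := by
      intro o
      rw [Set.encard_le_one_iff]
      intro a b ha hb
      exact Option.some.inj (ha.symm.trans hb)
    calc {x | G.src e = some x ∨ G.tgt e = some x}.encard
        ≤ {x | G.src e = some x}.encard + {x | G.tgt e = some x}.encard :=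
          Set.encard_union_le _ _
      _ ≤ 1 + 1 := add_le_add (h1 _) (h1 _)
      _ = 2 := one_add_one_eq_two

/-- No non-empty directed closed path. -/
def IsAcyclic : Prop :=
  ∀ x, ¬ Relation.TransGen (fun y z => ∃ e, G.src e = some y ∧ G.tgt e = some z) x x

end DirectedPartialGraph

/-! ### Proof structures -/

/-- The labels of the vertices of a proof structure. -/
inductive Rule : Type
  | ax
  | cut
  | tensor
  | par

/-- A directed partial graph whose vertices are labeled with rules and whose edges are labeled with
tagged formulas. -/
structure LabeledGraph (Atom : Type w) (V : Type u) (E : Type v) extends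
    DirectedPartialGraph V E where
  label : V → Rule
  type : E → TaggedFormula Atom

namespace LabeledGraph

variable {Atom : Type w} {V : Type u} {E : Type v} (ρ : LabeledGraph Atom V E)

/-- The premises of a vertex. -/
def premises (x : V) : Set E := {e | ρ.tgt e = some x}

/-- The conclusions of a vertex. -/
def conclusions (x : V) : Set E := {e | ρ.src e = some x}

/-- An initial edge is a premise of the whole graph or a conclusion of an `ax`-vertex. -/
def IsInitial (e : E) : Prop :=
  ρ.src e = none ∨ ∃ x, ρ.src e = some x ∧ ρ.label x = Rule.ax

/-- The incidence and typing constraints at a vertex. -/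
def VertexConstraint (x : V) : Prop :=
  match ρ.label x with
  | .ax => ∃ e f, e ≠ f ∧ ρ.premises x = ∅ ∧ ρ.conclusions x = {e, f} ∧
      (ρ.type e).AreDual (ρ.type f)
  | .cut => ∃ e f, e ≠ f ∧ ρ.premises x = {e, f} ∧ ρ.conclusions x = ∅ ∧
      (ρ.type e).AreDual (ρ.type f)
  | .tensor => ∃ e f c, e ≠ f ∧ ρ.premises x = {e, f} ∧ ρ.conclusions x = {c} ∧
      ∃ l, ρ.type c = .tensor l (ρ.type e) (ρ.type f)
  | .par => ∃ e f c, e ≠ f ∧ ρ.premises x = {e, f} ∧ ρ.conclusions x = {c} ∧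
      ∃ l, ρ.type c = .par l (ρ.type e) (ρ.type f)

/-- Proof structures. -/
structure IsProofStructure : Prop where
  finite_vertices : Finite V
  finite_edges : Finite E
  acyclic : ρ.IsAcyclic
  localized : ∀ e, (ρ.type e).IsLocalized
  vertex : ∀ x, ρ.VertexConstraint x
  initial_disjoint : ∀ e f, ρ.IsInitial e → ρ.IsInitial f → e ≠ f →
    (ρ.type e).locations.Disjoint (ρ.type f).locations

/-- Paths are taken in the underlying partial graph. -/
abbrev Path (x y : V) : Type (max u v) := ρ.toPartialGraph.Path x y

/-- `(e, x, f)` is a cusp: `x` is a `⅋`-vertex and `e`, `f` are its two premises. -/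
def HasCusp (e : E) (x : V) (f : E) : Prop :=
  ρ.label x = Rule.par ∧ e ≠ f ∧ e ∈ ρ.premises x ∧ f ∈ ρ.premises x

/-- A path is switching when it does not contain the two premises of any `⅋`-vertex. -/
def IsSwitching {x y : V} (p : ρ.Path x y) : Prop :=
  ∀ z e f, ρ.HasCusp e z f → ¬ (e ∈ p.edges ∧ f ∈ p.edges)

/-- A proof net is a proof structure without switching cycle (a DR-correct one). -/
def IsProofNet : Prop :=
  ρ.IsProofStructure ∧ ∀ (x : V) (p : ρ.Path x x), p.IsCycle → ¬ ρ.IsSwitching p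

/-- A proper cycle of `x`: a cycle of source `x`, with a cusp at `x` (between its last and first
edges) and no internal cusp. -/
def IsProperCycle {x : V} (p : ρ.Path x x) : Prop :=
  p.IsCycle ∧
  (∃ e f, p.edges.getLast? = some e ∧ p.edges.head? = some f ∧ ρ.HasCusp e x f) ∧
  ∀ e y f, (e, y, f) ∈ p.turns → ¬ ρ.HasCusp e y f

/-- Non-empty, and every `⅋`-vertex has a proper cycle. -/
def IsAlmostConnected : Prop :=
  Nonempty (V ⊕ E) ∧ ∀ x, ρ.label x = Rule.par → ∃ p : ρ.Path x x, ρ.IsProperCycle p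

/-- The choice, for each `⅋`-vertex, of one of its premises, to be disconnected from it. -/
structure Switching where
  removed : {x : V // ρ.label x = Rule.par} → E
  removed_mem : ∀ x, removed x ∈ ρ.premises x.1

open Classical in
/-- The correctness graph of a switching: the target of each chosen premise becomes undefined. -/
noncomputable def correctnessGraph (σ : ρ.Switching) : DirectedPartialGraph V E where
  src := ρ.src
  tgt e := if e ∈ Set.range σ.removed then none else ρ.tgt e

/-- DR-connectedness: each correctness graph has exactly one connected component. (For a proof net
the number of components does not depend on the correctness graph, and a proof structure always has
a correctness graph.) -/
def IsDRConnected : Prop :=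
  ∀ σ : ρ.Switching, (ρ.correctnessGraph σ).toPartialGraph.numComponents = 1

/-- Isomorphisms of labeled graphs. -/
structure Iso {V' : Type u} {E' : Type v} (τ : LabeledGraph Atom V' E') where
  vertexEquiv : V ≃ V'
  edgeEquiv : E ≃ E'
  src_eq : ∀ e, τ.src (edgeEquiv e) = (ρ.src e).map vertexEquiv
  tgt_eq : ∀ e, τ.tgt (edgeEquiv e) = (ρ.tgt e).map vertexEquiv
  label_eq : ∀ x, τ.label (vertexEquiv x) = ρ.label x
  type_eq : ∀ e, τ.type (edgeEquiv e) = ρ.type e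

end LabeledGraph

/-- The disjoint union of a finite family of labeled graphs. -/
def disjointUnion {Atom : Type w} {n : ℕ} {V : Fin n → Type u} {E : Fin n → Type v}
    (ρ : ∀ i, LabeledGraph Atom (V i) (E i)) :
    LabeledGraph Atom (Σ i, V i) (Σ i, E i) where
  src e := ((ρ e.1).src e.2).map (Sigma.mk e.1)
  tgt e := ((ρ e.1).tgt e.2).map (Sigma.mk e.1)
  label x := (ρ x.1).label x.2
  type e := (ρ e.1).type e.2

end ProofNets

/-! The argument takes place in the incidence graph, the bipartite simple graph on `V ⊕ E`. Each
⅋-vertex has its conclusion as distinguished neighbour `c`, and a cusp is a passage between two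
other neighbours. It suffices that cutting one premise at each ⅋-vertex disconnects nothing
(`reachable_of_removed`): the connected components of the net are then the required DR-connected
nets.

The core is a form of Yeo's theorem (`exists_splitting`): if every cycle has a cusp, some ⅋-vertex
is splitting, that is, the edge to its conclusion lies on no cycle. A vertex that is not splitting
has a successor for the strict order `Before`, obtained from a lasso with shortest remainder
(`Lasso.reroute`). By finiteness a maximal vertex exists, and it is splitting.

Connectedness follows by induction on the number of ⅋-vertices. Let `v` be splitting. A proper cycle
of another ⅋-vertex has no cusp at `v`, so passing through `v` would force it to use the conclusion
of `v`. Hence it avoids `v` and survives when `v` keeps only its conclusion (`pruneAt`), and the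
induction hypothesis applies there. The proper cycle of `v`, with `v` deleted, still links the two
premises of `v`, so the premise that is kept connects `v` to both. -/

namespace ProofNets

/-! ### Locally coloured graphs with one distinguished neighbour at some vertices -/

section Cusps

variable {α : Type*}

/-- `(a, b, d)` is not a cusp, for the cusps at the vertices `b ∈ P` being formed by two
neighbours both distinct from the distinguished one `c b`. -/
def NoCusp (P : Set α) (c : α → α) (a b d : α) : Prop := b ∈ P → a = c b ∨ d = c b

theorem NoCusp.symm {P : Set α} {c : α → α} {a b d : α} (h : NoCusp P c a b d) :
    NoCusp P c d b a := fun hb => (h hb).symm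

/-- A list of vertices is a walk without internal cusps. -/
structure Smooth (G : SimpleGraph α) (P : Set α) (c : α → α) (l : List α) : Prop where
  chain : l.IsChain G.Adj
  noCusp : ∀ a b d, [a, b, d] <:+: l → NoCusp P c a b d

/-- The list `x :: l` describes a cycle without cusp. -/
structure SmoothCycle (G : SimpleGraph α) (P : Set α) (c : α → α) (x : α) (l : List α) :
    Prop where
  smooth : Smooth G P c (x :: l ++ [x])
  nodup : (x :: l).Nodup
  two_le : 2 ≤ l.length
  closing : x ∈ P → l.head? = some (c x) ∨ l.getLast? = some (c x)

variable {G : SimpleGraph α} {P : Set α} {c : α → α}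

namespace Smooth

theorem of_infix {l k : List α} (h : Smooth G P c l) (hk : k <:+: l) : Smooth G P c k :=
  ⟨h.chain.infix hk, fun a b d hi => h.noCusp a b d (hi.trans hk)⟩

theorem reverse {l : List α} (h : Smooth G P c l) : Smooth G P c l.reverse := by
  refine ⟨?_, fun a b d hi => ?_⟩
  · rw [List.isChain_reverse]
    exact h.chain.imp fun _ _ hab => hab.symm
  · have := hi.reverse
    simp only [List.reverse_reverse] at this
    exact (h.noCusp d b a (by simpa using this)).symm

/-- Only the triple centred at `u` straddles the junction, so it is the only one to be checked. -/
theorem join {l k : List α} {u : α} (hl : Smooth G P c (l ++ [u])) (hk : Smooth G P c (u :: k))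
    (h : ∀ a ∈ l.getLast?, ∀ d ∈ k.head?, NoCusp P c a u d) : Smooth G P c (l ++ u :: k) := by
  refine ⟨List.isChain_split.2 ⟨hl.chain, hk.chain⟩, ?_⟩
  induction l with
  | nil => exact hk.noCusp
  | cons x l ih =>
    intro a b d hi
    rw [List.cons_append, List.infix_cons_iff] at hi
    rcases hi with hi | hi
    · cases l with
      | nil =>
        cases k with
        | nil => simp at hi
        | cons y k =>
          simp only [List.nil_append, List.cons_prefix_cons] at hi
          obtain ⟨rfl, rfl, rfl, -⟩ := hi
          exact h _ (by simp) _ (by simp)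
      | cons y l =>
        refine hl.noCusp a b d (List.IsPrefix.isInfix ?_)
        cases l <;> simp_all [List.cons_prefix_cons]
    · refine ih (hl.of_infix ⟨[x], [], by simp⟩) (fun a ha d hd => h a ?_ d hd) a b d hi
      cases l with
      | nil => simp at ha
      | cons y l => simpa using ha

theorem pair {x y : α} (h : G.Adj x y) : Smooth G P c [x, y] :=
  ⟨by simpa using h, fun a b d hi => by have := hi.length_le; simp at this⟩

end Smooth

theorem SmoothCycle.adj_head {x y : α} {l : List α} (h : SmoothCycle G P c x l)
    (hy : l.head? = some y) : G.Adj x y := by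
  have := h.smooth.chain
  cases l with
  | nil => simp at hy
  | cons z l =>
    simp at hy
    subst hy
    simp at this
    exact this.1

/-- Splitting a list at the first element satisfying a predicate. -/
theorem _root_.List.exists_first_split {p : α → Prop} :
    ∀ {l : List α}, (∃ x ∈ l, p x) →
      ∃ s x t, l = s ++ x :: t ∧ p x ∧ ∀ y ∈ s, ¬ p y
  | [], h => by simp at h
  | a :: l, h => by
    by_cases ha : p a
    · exact ⟨[], a, l, rfl, ha, by simp⟩
    · obtain ⟨x, hx, hp⟩ := h
      have hx' : x ∈ l := by
        rcases List.mem_cons.1 hx with rfl | hx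
        · exact absurd hp ha
        · exact hx
      obtain ⟨s, y, t, rfl, hy, hs⟩ := List.exists_first_split ⟨x, hx', hp⟩
      refine ⟨a :: s, y, t, rfl, hy, ?_⟩
      simpa using ⟨ha, hs⟩

/-- Splitting a list at the last element satisfying a predicate. -/
theorem _root_.List.exists_last_split {p : α → Prop} {l : List α} (h : ∃ x ∈ l, p x) :
    ∃ s x t, l = s ++ x :: t ∧ p x ∧ ∀ y ∈ t, ¬ p y := by
  obtain ⟨s, x, t, hl, hx, hs⟩ :=
    List.exists_first_split (l := l.reverse) (p := p) (by simpa using h)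
  refine ⟨t.reverse, x, s.reverse, ?_, hx, by simpa using hs⟩
  have := congrArg List.reverse hl
  simpa using this

/-- A cycle through `v`, starting with the distinguished neighbour of `v`, without cusp at `v`,
and whose part up to `u` is without cusp. -/
structure Lasso (G : SimpleGraph α) (P : Set α) (c : α → α) (v : α) (m : List α) (u : α)
    (r : List α) : Prop where
  chain : (v :: m ++ u :: r ++ [v]).IsChain G.Adj
  nodup : (v :: m ++ u :: r).Nodup
  smooth : Smooth G P c (v :: m ++ [u])
  head : (m ++ [u]).head? = some (c v)
  last : (u :: r).getLast? ≠ some (c v)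

/-- If there is no cusp at `u`, then the smooth part of a lasso extends up to a cusp. -/
theorem Lasso.exists_cusp (hG : ∀ x l, ¬ SmoothCycle G P c x l) {v u : α} {m r : List α}
    (h : Lasso G P c v m u r)
    (hu : ∀ a ∈ (v :: m).getLast?, ∀ d ∈ (r ++ [v]).head?, NoCusp P c a u d) :
    ∃ m' u' r', Lasso G P c v m' u' r' ∧ u' ∈ P ∧ (v :: m').getLast? ≠ some (c u') ∧
      (r' ++ [v]).head? ≠ some (c u') ∧ r'.length < r.length := by
  induction r generalizing m u with
  | nil =>
    -- With nothing left after `u`, the lasso is already a smooth cycle: leaving `v` by `c v` rules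
    -- out a cusp at `v`.
    refine absurd ?_ (hG v (m ++ [u]))
    have hc : G.Adj u v := by
      have := h.chain
      simp only [List.append_assoc, List.cons_append, List.nil_append] at this
      have := this.infix (l₁ := [u, v]) ⟨v :: m, [], by simp⟩
      simpa using this
    refine ⟨?_, h.nodup, ?_, fun _ => Or.inl h.head⟩
    · have := h.smooth.join (Smooth.pair (P := P) (c := c) hc) (by simpa using hu)
      simpa using this
    · cases m with
      | nil => exact absurd (by simpa using h.head) h.last
      | cons a m => simp
  | cons z r ih =>
    have hz : Lasso G P c v (m ++ [u]) z r := by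
      have hc : G.Adj u z := by
        have := h.chain
        have := this.infix (l₁ := [u, z]) ⟨v :: m, r ++ [v], by simp⟩
        simpa using this
      refine ⟨by simpa using h.chain, by simpa using h.nodup, ?_, ?_, by simpa using h.last⟩
      · have := h.smooth.join (Smooth.pair (P := P) (c := c) hc) (by simpa using hu)
        simpa using this
      · have := h.head
        cases m <;> simp_all
    by_cases hP : z ∈ P ∧ (v :: (m ++ [u])).getLast? ≠ some (c z) ∧ (r ++ [v]).head? ≠ some (c z)
    · exact ⟨_, z, r, hz, hP.1, hP.2.1, hP.2.2, by simp⟩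
    · obtain ⟨m', u', r', h1, h2, h3, h4, h5⟩ := ih hz (by
        intro a ha d hd hzP
        by_contra hcon
        rw [not_or] at hcon
        refine hP ⟨hzP, ?_, ?_⟩
        · rw [Option.mem_def.1 ha]; simpa using hcon.1
        · rw [Option.mem_def.1 hd]; simpa using hcon.2)
      exact ⟨m', u', r', h1, h2, h3, h4, h5.trans (by simp)⟩

/-- A smooth simple path leads from `v`, through its distinguished neighbour, to `u ∈ P`, not
through its distinguished neighbour, and smooth paths leaving `u` by its distinguished neighbour
cannot come back to it. -/
def Before (G : SimpleGraph α) (P : Set α) (c : α → α) (v u : α) : Prop :=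
  u ∈ P ∧ ∃ m, Smooth G P c (v :: m ++ [u]) ∧ (v :: m ++ [u]).Nodup ∧
    (m ++ [u]).head? = some (c v) ∧ (v :: m).getLast? ≠ some (c u) ∧
    ∀ q, Smooth G P c (u :: q) → (u :: q).Nodup → q.head? = some (c u) → q.Disjoint (v :: m)

theorem Before.irrefl (v : α) : ¬ Before G P c v v := by
  rintro ⟨-, m, -, h, -⟩
  simp at h

/-- The two paths are concatenated at `u`, where the second leaves by `c u`, so no cusp arises. The
last clause of `Before` makes them disjoint. For that clause at `t`, a path leaving `t` by `c t` is
prolonged backwards to `u`, where the clause for `u` applies. -/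
theorem Before.trans {v u t : α} (h : Before G P c v u) (k : Before G P c u t) :
    Before G P c v t := by
  obtain ⟨hu, m, h1, h2, h3, h4, h5⟩ := h
  obtain ⟨ht, m', k1, k2, k3, k4, k5⟩ := k
  refine ⟨ht, m ++ u :: m', ?_, ?_, ?_, ?_, ?_⟩
  · have := h1.join (k := m' ++ [t]) (by simpa using k1) (by
      intro a _ d hd _
      rw [k3] at hd
      exact Or.inr (by simpa using hd.symm))
    simpa using this
  · have hd := h5 (m' ++ [t]) (by simpa using k1) (by simpa using k2) k3
    have : (v :: m ++ (u :: m' ++ [t])).Nodup := by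
      refine List.Nodup.append (h2.sublist (by simp)) k2 ?_
      intro x hx hx'
      rw [List.cons_append, List.mem_cons] at hx'
      rcases hx' with rfl | hx'
      · exact (List.nodup_append.1 h2).2.2 x hx x (by simp) rfl
      · exact hd hx' hx
    simpa using this
  · cases m <;> simp_all
  · rw [← List.cons_append, List.getLast?_append_of_ne_nil _ (by simp)]
    exact k4
  · intro q q1 q2 q3
    have d1 := k5 q q1 q2 q3
    have d2 := h5 (m' ++ t :: q) (by
        have := k1.join q1 (by
          intro a _ d hd _
          rw [q3] at hd
          exact Or.inr (by simpa using hd.symm))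
        simpa using this)
      (by
        have : (u :: m' ++ (t :: q)).Nodup := by
          refine List.Nodup.append (k2.sublist (by simp)) q2 ?_
          intro x hx hx'
          rw [List.mem_cons] at hx'
          rcases hx' with rfl | hx'
          · exact (List.nodup_append.1 k2).2.2 x hx x (by simp) rfl
          · exact d1 hx' hx
        simpa using this)
      (by cases m' <;> simp_all)
    intro x hx hx'
    rw [← List.cons_append, List.mem_append] at hx'
    rcases hx' with hx' | hx'
    · exact d2 (by simp [hx]) hx'
    · exact d1 hx hx'

end Cusps

/-! ### Rerouting lassos and existence of a splitting vertex -/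

section Cusps

variable {α : Type*} {G : SimpleGraph α} {P : Set α} {c : α → α}

/-- Rerouting a lasso along a smooth path from `u` back to its smooth part: there is a lasso with
a shorter remainder. -/
theorem Lasso.reroute (hG : ∀ x l, ¬ SmoothCycle G P c x l) {v u : α} {m r q : List α}
    (h : Lasso G P c v m u r)
    (hlast : (v :: m).getLast? ≠ some (c u))
    (hq : Smooth G P c (u :: q)) (hqn : (u :: q).Nodup) (hqc : q.head? = some (c u))
    (hmeet : ∃ x ∈ q, x ∈ v :: m) :
    ∃ m' u' r', Lasso G P c v m' u' r' ∧ u' ∈ P ∧ (v :: m').getLast? ≠ some (c u') ∧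
      (r' ++ [v]).head? ≠ some (c u') ∧ r'.length < r.length := by
  obtain ⟨q1, x, q2, rfl, hx, hq1⟩ := List.exists_first_split hmeet
  replace hq : Smooth G P c (u :: q1 ++ [x]) := hq.of_infix ⟨[], q2, by simp⟩
  replace hqn : (u :: q1 ++ [x]).Nodup := hqn.sublist (by simp)
  replace hqc : (q1 ++ [x]).head? = some (c u) := by cases q1 <;> simp_all
  obtain ⟨m1, m2, hm⟩ := List.append_of_mem hx
  have hn := h.nodup
  rw [hm] at hn
  -- the cycle through `x` and `u` has a cusp at `x`
  have hcyc : ¬ (x ∈ P → (m2 ++ [u]).head? = some (c x) ∨ (u :: q1).getLast? = some (c x)) := by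
    intro hcl
    refine hG x (m2 ++ u :: q1) ⟨?_, ?_, ?_, ?_⟩
    · have h1 : Smooth G P c ((x :: m2) ++ [u]) :=
        h.smooth.of_infix ⟨m1, [], by rw [hm]; simp⟩
      have := h1.join (k := q1 ++ [x]) (by simpa using hq) (by
        intro a _ d hd _
        rw [hqc] at hd
        exact Or.inr (by simpa using hd.symm))
      simpa using this
    · have : (x :: m2 ++ u :: q1).Nodup := by
        refine List.Nodup.append (hn.sublist ?_) (hqn.sublist (by simp)) ?_
        · simp
        · intro y hy hy'
          rcases List.mem_cons.1 hy' with rfl | hy'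
          · refine (List.nodup_append.1 hn).2.2 y ?_ y (by simp) rfl
            simp [List.mem_cons.1 hy]
          · refine hq1 y hy' ?_
            rw [hm]; simp [List.mem_cons.1 hy]
      simpa using this
    -- Otherwise `m2` and `q1` are empty, and the lasso reaches `u` from `x = c u`, against `hlast`.
    · by_contra hlen
      have hm2 : m2 = [] := List.length_eq_zero_iff.1 (by simp at hlen; omega)
      have hq1' : q1 = [] := List.length_eq_zero_iff.1 (by simp at hlen; omega)
      subst hm2 hq1'
      rw [hm] at hlast
      simp at hqc hlast
      exact hlast hqc
    · intro hxP
      rcases hcl hxP with h1 | h1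
      · left; cases m2 <;> simp_all
      · right; rw [List.getLast?_append_of_ne_nil _ (by simp)]; exact h1
  rw [Classical.not_imp, not_or] at hcyc
  obtain ⟨hxP, hcx1, hcx2⟩ := hcyc
  -- `x` is not `v`
  obtain ⟨m1, rfl, rfl⟩ : ∃ m1', m1 = v :: m1' ∧ m = m1' ++ x :: m2 := by
    cases m1 with
    | nil =>
      simp only [List.nil_append, List.cons.injEq] at hm
      obtain ⟨rfl, rfl⟩ := hm
      exact absurd h.head hcx1
    | cons w m1 =>
      simp only [List.cons_append, List.cons.injEq] at hm
      obtain ⟨rfl, rfl⟩ := hm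
      exact ⟨m1, rfl, rfl⟩
  clear hm
  -- The lasso is smooth at `x` and does not leave it by `c x`, so it arrives from `c x`. It can
  -- therefore turn at `x` into `q` reversed without a cusp.
  have hm1 : (v :: m1).getLast? = some (c x) := by
    have hs : Smooth G P c ((v :: m1) ++ x :: (m2 ++ [u])) := by simpa using h.smooth
    obtain ⟨s, a, hsa⟩ : ∃ s a, v :: m1 = s ++ [a] :=
      ⟨_, _, (List.dropLast_append_getLast (by simp)).symm⟩
    obtain ⟨d, t, hdt⟩ : ∃ d t, m2 ++ [u] = d :: t := by cases m2 <;> simp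
    rw [hsa, hdt] at hs
    have := hs.noCusp a x d ⟨s, t, by simp⟩ hxP
    rw [hdt] at hcx1
    rw [hsa]
    simp at hcx1 ⊢
    tauto
  -- Following `q` backwards from `x`, `y` is the first vertex met on `u :: r`; `u` itself
  -- guarantees that there is one. The new lasso goes from `v` to `x`, back along `q` to `y`, then
  -- along the old remainder `r2`.
  obtain ⟨s1, y, s2, hs, hy, hs2⟩ :=
    List.exists_last_split (l := u :: q1) (p := fun y => y ∈ u :: r) ⟨u, by simp, by simp⟩
  obtain ⟨r1, r2, hr⟩ := List.append_of_mem hy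
  have hqs : u :: q1 ++ [x] = s1 ++ (y :: s2 ++ [x]) := by rw [hs]; simp
  have hnr : (v :: m1 ++ x :: m2 ++ r1 ++ y :: r2).Nodup := by
    have := h.nodup
    simp only [List.append_assoc, List.cons_append] at this
    rw [hr] at this
    simpa using this
  have hlas : Lasso G P c v (m1 ++ x :: s2.reverse) y r2 := by
    have hback : Smooth G P c (x :: s2.reverse ++ [y]) := by
      have : Smooth G P c (y :: s2 ++ [x]) := hq.of_infix (hqs ▸ ⟨s1, [], by simp⟩)
      simpa using this.reverse
    have hsm : Smooth G P c (v :: m1 ++ x :: (s2.reverse ++ [y])) := by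
      refine (h.smooth.of_infix ⟨[], m2 ++ [u], by simp⟩).join (by simpa using hback) ?_
      intro a ha _ _ _
      rw [hm1] at ha
      exact Or.inl (by simpa using ha.symm)
    refine ⟨?_, ?_, by simpa using hsm, ?_, ?_⟩
    · have h1 : (y :: r2 ++ [v]).IsChain G.Adj := by
        refine h.chain.infix ⟨v :: (m1 ++ x :: m2) ++ r1, [], ?_⟩
        simp only [List.append_assoc, List.cons_append] at hr ⊢
        rw [← List.cons_append (a := u), hr]; simp
      have : ((v :: m1 ++ x :: s2.reverse) ++ y :: (r2 ++ [v])).IsChain G.Adj :=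
        List.isChain_split.2 ⟨by simpa using hsm.chain, by simpa using h1⟩
      simpa using this
    · have h1 : (v :: m1 ++ [x] ++ (s2.reverse ++ y :: r2)).Nodup := by
        refine List.Nodup.append (hnr.sublist ?_) ?_ ?_
        · simp
        · refine List.Nodup.append ?_ (hnr.sublist (List.sublist_append_right _ _)) ?_
          · rw [List.nodup_reverse]
            refine hqn.sublist ?_
            rw [hqs]
            exact (((List.sublist_append_left s2 [x]).cons y).trans
              (List.sublist_append_right s1 _))
          · intro z hz hz'
            refine hs2 z (by simpa using hz) ?_
            rw [hr]; simp [List.mem_cons.1 hz']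
        · intro z hz hz'
          rcases List.mem_append.1 hz' with hz' | hz'
          · have hz2 : z ∈ s2 := by simpa using hz'
            have hz3 : z ∈ u :: q1 := by rw [hs]; simp [hz2]
            rcases List.mem_cons.1 hz3 with rfl | hz3
            · exact hs2 z hz2 (by simp)
            · refine hq1 z hz3 ?_
              simp only [List.mem_append, List.mem_cons, List.cons_append] at hz ⊢
              tauto
          · refine (List.nodup_append.1 hnr).2.2 z ?_ z hz' rfl
            simp only [List.mem_append, List.mem_cons, List.cons_append] at hz ⊢
            tauto
      simpa using h1
    · have := h.head
      cases m1 with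
      | nil => simpa using this
      | cons a m1 => simpa using this
    · have := h.last
      rwa [hr, List.getLast?_append_of_ne_nil _ (by simp)] at this
  by_cases hcusp : ∀ a ∈ (v :: (m1 ++ x :: s2.reverse)).getLast?, ∀ d ∈ (r2 ++ [v]).head?,
      NoCusp P c a y d
  · obtain ⟨m', u', r', k1, k2, k3, k4, k5⟩ := hlas.exists_cusp hG hcusp
    refine ⟨m', u', r', k1, k2, k3, k4, k5.trans_le ?_⟩
    have := congrArg List.length hr
    simp at this
    omega
  -- If `y = u`, the new lasso enters `u` from `c u`, so there is no cusp. A cusp at `y` thus forces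
  -- `y` further along, and `r2` is strictly shorter than `r`.
  · have hyu : r1 ≠ [] := by
      rintro rfl
      simp only [List.nil_append, List.cons.injEq] at hr
      obtain ⟨rfl, rfl⟩ := hr
      obtain rfl : s1 = [] := by
        cases s1 with
        | nil => rfl
        | cons a s1 =>
          simp only [List.cons_append, List.cons.injEq] at hs
          obtain ⟨rfl, rfl⟩ := hs
          simp at hqn
      simp only [List.nil_append, List.cons.injEq, true_and] at hs
      subst hs
      refine hcusp fun a ha d _ _ => Or.inl ?_
      rw [← List.cons_append, List.getLast?_append_of_ne_nil _ (by simp)] at ha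
      have : (x :: q1.reverse).getLast? = some (c u) := by
        rw [← hqc, ← List.head?_reverse]; simp
      rw [this] at ha
      simpa using ha.symm
    have hlen : r2.length < r.length := by
      have := congrArg List.length hr
      have h1 := List.length_pos_iff.2 hyu
      simp at this
      omega
    simp only [NoCusp, not_forall] at hcusp
    obtain ⟨a, ha, d, hd, hyP, hcu⟩ := hcusp
    rw [not_or] at hcu
    refine ⟨_, y, r2, hlas, hyP, ?_, ?_, hlen⟩
    · rw [Option.mem_def.1 ha]; simpa using hcu.1
    · rw [Option.mem_def.1 hd]; simpa using hcu.2

/-- A vertex is splitting when no cycle passes through it and its distinguished neighbour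
without forming a cusp. -/
def Splitting (G : SimpleGraph α) (c : α → α) (v : α) : Prop :=
  ∀ l : List α, (v :: l ++ [v]).IsChain G.Adj → (v :: l).Nodup →
    l.head? = some (c v) → l.getLast? = some (c v)

/-- Among the lassos stopped at a cusp, take one with shortest remainder. A smooth path leaving its
end by the distinguished neighbour and meeting the smooth part would allow a rerouting to a shorter
remainder. -/
theorem exists_before_of_not_splitting (hG : ∀ x l, ¬ SmoothCycle G P c x l) {v : α}
    (hv : ¬ Splitting G c v) : ∃ u, Before G P c v u := by
  classical
  simp only [Splitting, not_forall] at hv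
  obtain ⟨l, hl1, hl2, hl3, hl4⟩ := hv
  have hex : ∃ n m u r, Lasso G P c v m u r ∧ u ∈ P ∧ (v :: m).getLast? ≠ some (c u) ∧
      (r ++ [v]).head? ≠ some (c u) ∧ r.length = n := by
    cases l with
    | nil => simp at hl3
    | cons y r =>
      have hy : y = c v := by simpa using hl3
      have hadj : G.Adj v y := by
        simp at hl1
        exact hl1.1
      have h0 : Lasso G P c v [] y r :=
        ⟨by simpa using hl1, by simpa using hl2, Smooth.pair hadj, by simp [hy], hl4⟩
      by_cases hc : ∀ a ∈ [v].getLast?, ∀ d ∈ (r ++ [v]).head?, NoCusp P c a y d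
      · obtain ⟨m, u, r', k1, k2, k3, k4, -⟩ := h0.exists_cusp hG hc
        exact ⟨_, m, u, r', k1, k2, k3, k4, rfl⟩
      · simp only [NoCusp, not_forall] at hc
        obtain ⟨a, ha, d, hd, hyP, hcu⟩ := hc
        rw [not_or] at hcu
        refine ⟨_, [], y, r, h0, hyP, ?_, ?_, rfl⟩
        · rw [Option.mem_def.1 ha]; simpa using hcu.1
        · rw [Option.mem_def.1 hd]; simpa using hcu.2
  obtain ⟨m, u, r, h1, h2, h3, h4, h5⟩ := Nat.find_spec hex
  refine ⟨u, h2, m, h1.smooth, h1.nodup.sublist (by simp), h1.head, h3,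
    fun q q1 q2 q3 x hx hx' => ?_⟩
  obtain ⟨m', u', r', k1, k2, k3, k4, k5⟩ := h1.reroute hG h3 q1 q2 q3 ⟨x, hx, hx'⟩
  exact Nat.find_min hex (h5 ▸ k5) ⟨m', u', r', k1, k2, k3, k4, rfl⟩

/-- A graph without cusp-free cycle has a splitting vertex in each non-empty set dominating the
cusps. -/
theorem exists_splitting [Finite α] (hG : ∀ x l, ¬ SmoothCycle G P c x l) (hP : P.Nonempty) :
    ∃ v ∈ P, Splitting G c v := by
  -- The relation is reversed, so that a minimal element has no successor for `Before` in `P`.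
  have : IsTrans α (fun a b => Before G P c b a) := ⟨fun _ _ _ h k => k.trans h⟩
  have : Std.Irrefl (fun a b => Before G P c b a) := ⟨fun a => Before.irrefl a⟩
  have hwf := Finite.wellFounded_of_trans_of_irrefl (fun a b => Before G P c b a)
  obtain ⟨v, hv, hmin⟩ := hwf.has_min P hP
  refine ⟨v, hv, by_contra fun hs => ?_⟩
  obtain ⟨u, hu⟩ := exists_before_of_not_splitting hG hs
  exact hmin u hu.1 hu

end Cusps

/-! ### Proper cycles, pruning at a splitting vertex, and connectedness after removals -/

theorem _root_.List.Nodup.length_le_one_of_head?_eq_getLast? {α : Type*} {k : List α}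
    (hk : k.Nodup) (h : k.head? = k.getLast?) : k.length ≤ 1 := by
  cases k with
  | nil => simp
  | cons b k =>
    cases k using List.reverseRecOn with
    | nil => simp
    | append_singleton k e =>
      rw [← List.cons_append, List.getLast?_append_of_ne_nil _ (by simp)] at h
      simp at h
      subst h
      simp at hk

section Cusps

variable {α : Type*} {G : SimpleGraph α} {P : Set α} {c : α → α}

/-- The list `p :: l` describes a cycle whose only cusp is at `p`, and which contains all the
neighbours of `p` but the distinguished one. -/
structure ProperCycle (G : SimpleGraph α) (P : Set α) (c : α → α) (p : α) (l : List α) :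
    Prop where
  smooth : Smooth G P c (p :: l ++ [p])
  nodup : (p :: l).Nodup
  two_le : 2 ≤ l.length
  head : l.head? ≠ some (c p)
  last : l.getLast? ≠ some (c p)
  mem : ∀ d, G.Adj p d → d ≠ c p → l.head? = some d ∨ l.getLast? = some d

/-- The only cusp of the cycle is at `p ≠ v`, so one neighbour of `v` on it is `c v`. Rotating the
cycle to `v`, splitting makes the other neighbour `c v` too, which is impossible in a cycle. -/
theorem ProperCycle.notMem_of_splitting {p v : α} {l : List α} (h : ProperCycle G P c p l)
    (hv : v ∈ P) (hs : Splitting G c v) : v ∉ l := by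
  intro hvl
  obtain ⟨l1, l2, rfl⟩ := List.append_of_mem hvl
  have hn := h.nodup
  obtain ⟨s, a, hsa⟩ : ∃ s a, p :: l1 = s ++ [a] :=
    ⟨_, _, (List.dropLast_append_getLast (by simp)).symm⟩
  obtain ⟨d, t, hdt⟩ : ∃ d t, l2 ++ [p] = d :: t := by cases l2 <;> simp
  have hfull : p :: (l1 ++ v :: l2) ++ [p] = (p :: l1) ++ v :: (l2 ++ [p]) := by simp
  have hT : a = c v ∨ d = c v := by
    refine h.smooth.noCusp a v d ?_ hv
    rw [hfull, hsa, hdt]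
    exact ⟨s, t, by simp⟩
  have hla : (p :: l1).getLast? = some a := by rw [hsa]; simp
  have hhd : (l2 ++ [p]).head? = some d := by rw [hdt]; simp
  have hrot : (v :: (l2 ++ p :: l1)).Nodup := by
    have : ((p :: l1) ++ (v :: l2)).Nodup := by simpa using hn
    simpa using List.nodup_append_comm.1 this
  have hch : (v :: (l2 ++ p :: l1) ++ [v]).IsChain G.Adj := by
    have hc := h.smooth.chain
    rw [hfull] at hc
    have h1 : (p :: l1 ++ [v]).IsChain G.Adj := hc.infix ⟨[], l2 ++ [p], by simp⟩
    have h2 : (v :: l2 ++ [p]).IsChain G.Adj := hc.infix ⟨p :: l1, [], by simp⟩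
    have : ((v :: l2) ++ p :: (l1 ++ [v])).IsChain G.Adj :=
      List.isChain_split.2 ⟨h2, by simpa using h1⟩
    simpa using this
  have hhead : (l2 ++ p :: l1).head? = some d := by
    cases l2 <;> simp_all
  have hlast : (l2 ++ p :: l1).getLast? = some a := by
    rw [List.getLast?_append_of_ne_nil _ (by simp), hla]
  -- both neighbours of `v` in the cycle are its distinguished neighbour
  have had : a = d := by
    rcases hT with rfl | rfl
    · have := hs (l2 ++ p :: l1).reverse
        (by
          have h1 : (v :: (l2 ++ p :: l1) ++ [v]).reverse.IsChain G.Adj :=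
            List.isChain_reverse.2 (hch.imp fun _ _ hab => hab.symm)
          simpa only [List.reverse_append, List.reverse_cons, List.reverse_nil, List.nil_append,
            List.cons_append] using h1)
        (by
          rw [List.nodup_cons] at hrot ⊢
          rwa [List.mem_reverse, List.nodup_reverse])
        (by rw [List.head?_reverse, hlast])
      rw [List.getLast?_reverse, hhead] at this
      simpa using this.symm
    · have := hs _ hch hrot hhead
      rw [hlast] at this
      simpa using this
  subst had
  have := (List.nodup_cons.1 hrot).2.length_le_one_of_head?_eq_getLast? (by rw [hhead, hlast])
  have h2 := h.two_le
  simp at this h2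
  omega

/-- The graph obtained by keeping, among the edges at `v`, the distinguished one only. -/
def pruneAt (G : SimpleGraph α) (c : α → α) (v : α) : SimpleGraph α where
  Adj a b := G.Adj a b ∧ (a = v → b = c v) ∧ (b = v → a = c v)
  symm := ⟨fun _ _ h => ⟨h.1.symm, h.2.2, h.2.1⟩⟩
  loopless := ⟨fun _ h => h.1.ne rfl⟩

/-- After pruning, `v` has at most one neighbour, so it lies on no cycle, and removing it from `P`
loses no cusp condition. -/
theorem pruneAt_smoothCycle {v x : α} {l : List α}
    (h : SmoothCycle (pruneAt G c v) (P \ {v}) c x l) : SmoothCycle G P c x l := by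
  have hv : v ∉ x :: l := by
    intro hv
    rcases List.mem_cons.1 hv with rfl | hv
    · obtain ⟨a, ha⟩ : ∃ a, l.head? = some a := by
        cases l with
        | nil => have := h.two_le; simp at this
        | cons a l => exact ⟨a, rfl⟩
      obtain ⟨s, d, hd⟩ : ∃ s d, l = s ++ [d] := by
        cases l using List.reverseRecOn with
        | nil => have := h.two_le; simp at this
        | append_singleton s d => exact ⟨s, d, rfl⟩
      have h1 := (h.adj_head ha).2.1 rfl
      have h2 : (pruneAt G c v).Adj d v := by
        have := h.smooth.chain.infix (l₁ := [d, v]) ⟨v :: s, [], by rw [hd]; simp⟩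
        simpa using this
      have h3 := h2.2.2 rfl
      have h4 := (List.nodup_cons.1 h.nodup).2.length_le_one_of_head?_eq_getLast?
        (by rw [ha, hd, h1, h3]; simp)
      have := h.two_le
      omega
    · obtain ⟨l1, l2, rfl⟩ := List.append_of_mem hv
      obtain ⟨s, a, hsa⟩ : ∃ s a, x :: l1 = s ++ [a] :=
        ⟨_, _, (List.dropLast_append_getLast (by simp)).symm⟩
      obtain ⟨d, t, hdt⟩ : ∃ d t, l2 ++ [x] = d :: t := by cases l2 <;> simp
      have hfull : x :: (l1 ++ v :: l2) ++ [x] = s ++ [a, v, d] ++ t := by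
        have : x :: (l1 ++ v :: l2) ++ [x] = (x :: l1) ++ v :: (l2 ++ [x]) := by simp
        rw [this, hsa, hdt]; simp
      have hch := h.smooth.chain.infix (l₁ := [a, v, d]) ⟨s, t, hfull.symm⟩
      simp only [List.isChain_cons_cons, List.isChain_singleton, and_true] at hch
      have h1 := hch.1.2.2 rfl
      have h2 := hch.2.2.1 rfl
      have hn : ((x :: l1) ++ (v :: l2)).Nodup := by simpa using h.nodup
      have hrot := List.nodup_append_comm.1 hn
      have hhead : (l2 ++ x :: l1).head? = some d := by
        have : (l2 ++ [x]).head? = some d := by rw [hdt]; rfl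
        cases l2 <;> simp_all
      have hlast : (l2 ++ x :: l1).getLast? = some a := by
        rw [List.getLast?_append_of_ne_nil _ (by simp), hsa]; simp
      have h4 := (List.nodup_cons.1 hrot).2.length_le_one_of_head?_eq_getLast?
        (hhead.trans (by rw [h2, ← h1]; exact hlast.symm))
      have := h.two_le
      simp at this h4
      omega
  have hv' : ∀ y ∈ x :: l ++ [x], y ≠ v := by
    rintro y hy rfl
    apply hv
    simp at hy ⊢
    tauto
  refine ⟨⟨h.smooth.chain.imp fun _ _ hab => hab.1, fun a b d hi hb =>
    h.smooth.noCusp a b d hi ⟨hb, hv' b (hi.subset (by simp))⟩⟩, h.nodup, h.two_le,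
    fun hx => h.closing ⟨hx, hv' x (by simp)⟩⟩

/-- If each vertex of `P` has a proper cycle, then removing one edge (other than the distinguished
one) at each vertex of `P` does not disconnect vertices. -/
theorem reachable_of_removed [Finite α] (hG : ∀ x l, ¬ SmoothCycle G P c x l)
    (hind : ∀ p ∈ P, ∀ q ∈ P, ¬ G.Adj p q) (hprop : ∀ p ∈ P, ∃ l, ProperCycle G P c p l)
    {s : α → α} (hs : ∀ p ∈ P, s p ≠ c p) {H : SimpleGraph α}
    (hH : ∀ a b, G.Adj a b → (a ∈ P → b ≠ s a) → (b ∈ P → a ≠ s b) → H.Adj a b)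
    {a b : α} (hab : G.Adj a b) : H.Reachable a b := by
  induction hn : P.ncard generalizing G P a b with
  | zero =>
    rw [Set.ncard_eq_zero] at hn
    subst hn
    exact (hH a b hab (by simp) (by simp)).reachable
  | succ n ih =>
    have hne : P.Nonempty := by
      rw [← Set.ncard_pos]; omega
    obtain ⟨v, hv, hsplit⟩ := exists_splitting hG hne
    -- The target graph `H` stays the same in the induction: the only edge kept at `v` goes to `c v
    -- ≠ s v`, so it is never the removed one.
    have key : ∀ a b, (pruneAt G c v).Adj a b → H.Reachable a b := by
      intro a b hab
      refine ih (G := pruneAt G c v) (P := P \ {v}) (fun x l h => hG x l (pruneAt_smoothCycle h))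
        (fun p hp q hq h => hind p hp.1 q hq.1 h.1) ?_ (fun p hp => hs p hp.1) ?_ hab ?_
      · intro p hp
        obtain ⟨l, hl⟩ := hprop p hp.1
        have hvl := hl.notMem_of_splitting hv hsplit
        have hv' : ∀ y ∈ p :: l ++ [p], y ≠ v := by
          rintro y hy rfl
          simp only [List.cons_append, List.mem_cons, List.mem_append, List.not_mem_nil,
            or_false] at hy
          have := hp.2
          rw [Set.mem_singleton_iff] at this
          rcases hy with hy | hy | hy
          · exact this hy.symm
          · exact hvl hy
          · exact this hy.symm
        refine ⟨l, ⟨hl.smooth.chain.imp_of_mem_imp fun a b ha hb h =>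
          ⟨h, fun e => absurd e (hv' a ha), fun e => absurd e (hv' b hb)⟩,
          fun a b d hi hb => hl.smooth.noCusp a b d hi hb.1⟩, hl.nodup, hl.two_le, hl.head,
          hl.last, fun d hd => hl.mem d hd.1⟩
      · intro a b hab h1 h2
        refine hH a b hab.1 (fun ha hb => ?_) (fun hb ha => ?_)
        · by_cases hav : a = v
          · subst hav
            exact hs a ha (hb ▸ hab.2.1 rfl)
          · exact h1 ⟨ha, hav⟩ hb
        · by_cases hbv : b = v
          · subst hbv
            exact hs b hb (ha ▸ hab.2.2 rfl)
          · exact h2 ⟨hb, hbv⟩ ha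
      · rw [Set.ncard_sdiff_singleton_of_mem hv, hn]; rfl
    have keyv : ∀ d, G.Adj v d → H.Reachable v d := by
      intro d hd
      by_cases hdc : d = c v
      · exact key v d ⟨hd, fun _ => hdc, fun e => absurd e hd.ne'⟩
      obtain ⟨l, hl⟩ := hprop v hv
      have hvl := (List.nodup_cons.1 hl.nodup).1
      obtain ⟨e, k, f, rfl⟩ : ∃ e k f, l = e :: (k ++ [f]) := by
        have := hl.two_le
        cases l with
        | nil => simp at this
        | cons e k =>
          cases k using List.reverseRecOn with
          | nil => simp at this
          | append_singleton k f => exact ⟨e, k, f, rfl⟩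
      have hlast : (e :: (k ++ [f])).getLast? = some f := by
        rw [← List.cons_append, List.getLast?_append_of_ne_nil _ (by simp)]; rfl
      -- The proper cycle of `v` without `v` lies in the pruned graph, so `key` transports it to
      -- `H`.
      have hef : H.Reachable e f := by
        have hch : (e :: (k ++ [f])).IsChain G.Adj :=
          hl.smooth.chain.infix ⟨[v], [v], by simp⟩
        have hch2 : (e :: (k ++ [f])).IsChain H.Reachable :=
          hch.imp_of_mem_imp fun a b ha hb h => key a b
            ⟨h, fun e => absurd ha (e ▸ hvl), fun e => absurd hb (e ▸ hvl)⟩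
        have hR := List.relationReflTransGen_of_exists_isChain_cons _ hch2
          (b := f) (by simp)
        clear * - hR
        induction hR with
        | refl => exact SimpleGraph.Reachable.refl _
        | tail _ h ih => exact ih.trans h
      have hne : e ≠ f := by
        rintro rfl
        have := (List.nodup_cons.1 hl.nodup).2
        simp at this
      have hve : G.Adj v e := by
        have := hl.smooth.chain.infix (l₁ := [v, e]) ⟨[], k ++ [f, v], by simp⟩
        simpa using this
      have hvf : G.Adj v f := by
        have := hl.smooth.chain.infix (l₁ := [f, v]) ⟨v :: e :: k, [], by simp⟩
        exact (by simpa using this : G.Adj f v).symm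
      have hstep : ∀ d, G.Adj v d → d ≠ s v → H.Reachable v d := fun d hd h =>
        (hH v d hd (fun _ => h) (fun hdP => absurd hd (hind v hv d hdP))).reachable
      -- At most one of `e`, `f` is removed at `v`; the other is still adjacent to `v`, and `hef`
      -- does the rest.
      have hboth : H.Reachable v e ∧ H.Reachable v f := by
        by_cases hes : e = s v
        · have := hstep f hvf (fun h => hne (hes.trans h.symm))
          exact ⟨this.trans hef.symm, this⟩
        · have := hstep e hve hes
          exact ⟨this, this.trans hef⟩
      rcases hl.mem d hd hdc with h | h
      · obtain rfl : e = d := by simpa using h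
        exact hboth.1
      · rw [hlast] at h
        obtain rfl : f = d := by simpa using h
        exact hboth.2
    by_cases hav : a = v
    · subst hav; exact keyv b hab
    by_cases hbv : b = v
    · subst hbv; exact (keyv a hab.symm).symm
    exact key a b ⟨hab, fun e => absurd e hav, fun e => absurd e hbv⟩

end Cusps

/-! ### Rotation of cycles -/

section Cusps

variable {α : Type*} {G : SimpleGraph α} {P : Set α} {c : α → α}

/-- In the incidence graph this says that a cycle crosses each edge between two distinct endpoints,
as paths require. -/
theorem ne_of_infix_cycle {x a b d : α} {l : List α} (hn : (x :: l).Nodup) (hl : 2 ≤ l.length)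
    (h : [a, b, d] <:+: x :: l ++ [x]) : a ≠ d := by
  rintro rfl
  obtain ⟨s, t, h⟩ := h
  cases s with
  | nil =>
    cases t using List.reverseRecOn with
    | nil =>
      have := congrArg List.length h
      simp at this
      omega
    | append_singleton t e =>
      rw [← List.append_assoc] at h
      obtain ⟨h, -⟩ := List.append_inj' h rfl
      rw [← h] at hn
      simp at hn
  | cons y s =>
    simp only [List.cons_append, List.cons.injEq] at h
    have hn' : (l ++ [x]).Nodup := List.nodup_append_comm.1 (by simpa using hn)
    rw [← h.2] at hn'
    have := hn'.sublist (l₁ := [a, b, a])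
      (List.infix_append s [a, b, a] t).sublist
    simp at this

/-- The closing condition at `x` becomes an internal one, and the internal one at `y` becomes the
closing condition. -/
theorem SmoothCycle.rotate {x y : α} {l : List α} (h : SmoothCycle G P c x (y :: l)) :
    SmoothCycle G P c y (l ++ [x]) := by
  have hadj : G.Adj x y := h.adj_head rfl
  refine ⟨?_, ?_, ?_, ?_⟩
  · have h1 : Smooth G P c ((y :: l) ++ [x]) := h.smooth.of_infix ⟨[x], [], by simp⟩
    have := h1.join (Smooth.pair hadj) (by
      intro a ha d hd hx
      rcases h.closing hx with h2 | h2
      · right; simp at h2 hd; exact hd ▸ h2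
      · left; rw [h2] at ha; simpa using ha.symm)
    simpa using this
  · have : ([x] ++ (y :: l)).Nodup := h.nodup
    simpa using List.nodup_append_comm.1 this
  · simpa using h.two_le
  · intro hy
    obtain ⟨d, t, hdt⟩ : ∃ d t, l ++ [x] = d :: t := by cases l <;> simp
    have := h.smooth.noCusp x y d ⟨[], t, by
      rw [List.cons_append, List.cons_append, hdt]; simp⟩ hy
    rcases this with h1 | h1
    · right; rw [← h1]; simp
    · left; rw [hdt, ← h1]; rfl

theorem SmoothCycle.rotate_to {x y : α} {l : List α} (h : SmoothCycle G P c x l)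
    (hy : y ∈ x :: l) : ∃ k, SmoothCycle G P c y k ∧ ∀ z, z ∈ y :: k ↔ z ∈ x :: l := by
  rcases List.mem_cons.1 hy with rfl | hy
  · exact ⟨l, h, fun _ => Iff.rfl⟩
  obtain ⟨l1, l2, rfl⟩ := List.append_of_mem hy
  clear * - h
  induction l1 generalizing x l2 with
  | nil => exact ⟨_, h.rotate, fun z => by simp; tauto⟩
  | cons a l1 ih =>
    obtain ⟨k, hk, hmem⟩ := ih (l2 ++ [x]) (x := a) (by simpa using h.rotate)
    exact ⟨k, hk, fun z => (hmem z).trans (by simp; tauto)⟩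

end Cusps

/-! ### Incidence graphs -/

namespace PartialGraph

variable {V : Type u} {E : Type v} (G : PartialGraph V E)

/-- The bipartite graph of the incidences between the vertices and edges of a partial graph. -/
def incidence : SimpleGraph (V ⊕ E) where
  Adj
    | .inl x, .inr e => x ∈ G.inc e
    | .inr e, .inl x => x ∈ G.inc e
    | _, _ => False
  symm := ⟨by rintro (x | e) (y | f) h <;> exact h⟩
  loopless := ⟨by rintro (x | e) h <;> exact h⟩

variable {G}

@[simp] theorem incidence_inl_inr {x : V} {e : E} :
    G.incidence.Adj (.inl x) (.inr e) ↔ x ∈ G.inc e := Iff.rfl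

@[simp] theorem incidence_inr_inl {x : V} {e : E} :
    G.incidence.Adj (.inr e) (.inl x) ↔ x ∈ G.inc e := Iff.rfl

@[simp] theorem not_incidence_inl_inl {x y : V} : ¬ G.incidence.Adj (.inl x) (.inl y) := id

@[simp] theorem not_incidence_inr_inr {e f : E} : ¬ G.incidence.Adj (.inr e) (.inr f) := id

theorem joins_of_mem {e : E} {x y : V} (hx : x ∈ G.inc e) (hy : y ∈ G.inc e) (h : x ≠ y) :
    G.Joins e x y := by
  refine ⟨h, (Set.Finite.eq_of_subset_of_encard_le (Set.toFinite ({x, y} : Set V))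
    (Set.pair_subset hx hy) ?_).symm⟩
  rw [Set.encard_pair h]
  exact G.encard_inc_le e

theorem VLinked.reachable {x y : V} (h : G.VLinked x y) :
    G.incidence.Reachable (.inl x) (.inl y) := by
  obtain ⟨p⟩ := h
  induction p with
  | nil x => exact .refl _
  | @cons x y z e h p ih =>
    have h1 : G.incidence.Adj (.inl x) (.inr e) := by simp [h.2]
    have h2 : G.incidence.Adj (.inr e) (.inl y) := by simp [h.2]
    exact (h1.reachable.trans h2.reachable).trans ih

theorem linked_iff_reachable {a b : V ⊕ E} : G.Linked a b ↔ G.incidence.Reachable a b := by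
  constructor
  · rcases a with x | e <;> rcases b with y | f
    · exact VLinked.reachable
    · rintro ⟨y, hy, h⟩
      exact h.reachable.trans (SimpleGraph.Adj.reachable (by simpa using hy))
    · rintro ⟨y, hy, h⟩
      exact (SimpleGraph.Adj.reachable (by simpa using hy)).trans h.reachable
    · rintro (rfl | ⟨x, hx, y, hy, h⟩)
      · exact .refl _
      · exact (SimpleGraph.Adj.reachable (by simpa using hx)).trans
          (h.reachable.trans (SimpleGraph.Adj.reachable (by simpa using hy)))
  · rintro ⟨p⟩
    induction p with
    | nil => exact G.linked_equivalence.refl _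
    | @cons a b d hab p ih =>
      refine G.linked_equivalence.trans ?_ ih
      rcases a with x | e <;> rcases b with y | f
      · exact absurd hab not_incidence_inl_inl
      · exact ⟨x, hab, VLinked.refl G x⟩
      · exact ⟨y, hab, VLinked.refl G y⟩
      · exact absurd hab not_incidence_inr_inr

theorem numComponents_eq_one_iff :
    G.numComponents = 1 ↔ Nonempty (V ⊕ E) ∧ ∀ a b, G.incidence.Reachable a b := by
  unfold numComponents
  rw [Nat.card_eq_one_iff_unique, and_comm]
  refine and_congr ⟨fun ⟨q⟩ => ⟨q.out⟩, fun ⟨a⟩ => ⟨Quotient.mk _ a⟩⟩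
    ⟨fun h a b => ?_, fun h => ⟨fun q r => ?_⟩⟩
  · exact linked_iff_reachable.1 (Quotient.exact (s := G.linkedSetoid) (Subsingleton.elim _ _))
  · induction q using Quotient.inductionOn
    induction r using Quotient.inductionOn
    exact Quotient.sound (s := G.linkedSetoid) (linked_iff_reachable.2 (h _ _))

namespace Path

/-- The alternating list of the vertices and edges of a path. -/
def toList : ∀ {x y : V}, G.Path x y → List (V ⊕ E)
  | _, _, .nil x => [.inl x]
  | x, _, .cons e _ p => .inl x :: .inr e :: p.toList

theorem toList_eq_cons {x y : V} (p : G.Path x y) : ∃ l, p.toList = .inl x :: l := by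
  cases p <;> exact ⟨_, rfl⟩

theorem edges_eq {x y : V} (p : G.Path x y) : p.edges = p.toList.filterMap Sum.getRight? := by
  induction p with
  | nil x => rfl
  | cons e h p ih => simp [edges, toList, ih, List.filterMap_cons]

theorem support_eq {x y : V} (p : G.Path x y) : p.support = p.toList.filterMap Sum.getLeft? := by
  induction p with
  | nil x => rfl
  | cons e h p ih => simp [support, toList, ih, List.filterMap_cons]

theorem length_toList {x y : V} (p : G.Path x y) : p.toList.length = 2 * p.edges.length + 1 := by
  induction p with
  | nil x => rfl
  | cons e h p ih => simp [edges, toList, ih]; omega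

theorem isChain_toList {x y : V} (p : G.Path x y) : p.toList.IsChain G.incidence.Adj := by
  induction p with
  | nil x => simp [toList]
  | cons e h p ih =>
    obtain ⟨l, hl⟩ := p.toList_eq_cons
    rw [toList, hl]
    rw [hl] at ih
    simp [ih, h.2]

theorem head?_edges {x y : V} {p : G.Path x y} {e : E} (h : p.edges.head? = some e) :
    ∃ l, p.toList = .inl x :: .inr e :: l := by
  cases p with
  | nil => simp [edges] at h
  | cons f hf p =>
    obtain rfl : f = e := by simpa [edges] using h
    exact ⟨_, rfl⟩

theorem getLast?_edges {x y : V} {p : G.Path x y} {e : E} (h : p.edges.getLast? = some e) :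
    ∃ l, p.toList = l ++ [.inr e, .inl y] := by
  induction p with
  | nil => simp [edges] at h
  | @cons x y z f hf p ih =>
    cases p with
    | nil =>
      obtain rfl : f = e := by simpa [edges] using h
      exact ⟨[.inl x], rfl⟩
    | cons g hg p =>
      obtain ⟨l, hl⟩ := ih (by simpa [edges] using h)
      exact ⟨.inl x :: .inr f :: l, by rw [toList, hl]; rfl⟩

theorem mem_turns {x z y : V} {p : G.Path x z} {e f : E}
    (h : [.inr e, .inl y, .inr f] <:+: p.toList) : (e, y, f) ∈ p.turns := by
  induction p with
  | nil => have := h.length_le; simp [toList] at this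
  | cons g hg p ih =>
    rw [toList, List.infix_cons_iff, List.infix_cons_iff] at h
    rcases h with h | h | h
    · simp [List.cons_prefix_cons] at h
    · cases p with
      | nil => simp [toList, List.cons_prefix_cons] at h
      | cons k hk p =>
        simp only [toList, List.cons_prefix_cons, Sum.inr.injEq, Sum.inl.injEq] at h
        obtain ⟨rfl, rfl, rfl, -⟩ := h
        simp [turns, edges, support]
    · have := ih h
      cases p with
      | nil => simp [turns, edges] at this
      | cons k hk p =>
        simp only [turns, edges, support, List.tail_cons] at this ⊢
        simp only [List.zip_cons_cons, List.mem_cons]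
        right
        exact this

/-- A walk in the bipartite graph alternates vertices and edges; the absence of backtracking makes
the endpoints of each step distinct. -/
theorem exists_toList_eq : ∀ (L : List (V ⊕ E)) {x z : V}, L.IsChain G.incidence.Adj →
    L.head? = some (.inl x) → L.getLast? = some (.inl z) →
    (∀ a b d, [a, b, d] <:+: L → a ≠ d) → ∃ p : G.Path x z, p.toList = L
  | [], _, _, _, h, _, _ => by simp at h
  | [a], x, z, _, h, k, _ => by
    simp at h k
    subst h
    obtain rfl : x = z := by simpa using k
    exact ⟨.nil x, rfl⟩
  | [a, b], x, z, hc, h, k, _ => by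
    simp at h k hc
    subst h k
    exact absurd hc not_incidence_inl_inl
  | a :: b :: d :: L, x, z, hc, h, k, hn => by
    have hx : a = .inl x := by simpa using h
    subst hx
    simp only [List.isChain_cons_cons] at hc
    obtain ⟨h1, h2, h3⟩ := hc
    rcases b with y | e
    · exact absurd h1 not_incidence_inl_inl
    rcases d with y | f
    swap
    · exact absurd h2 not_incidence_inr_inr
    have hxy : x ≠ y := fun he =>
      hn (.inl x) (.inr e) (.inl y) ⟨[], L, rfl⟩ (by rw [he])
    obtain ⟨p, hp⟩ := exists_toList_eq (.inl y :: L) (x := y) (z := z) h3 rfl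
      (by simpa using k)
      (fun a b d hi => hn a b d (hi.trans ⟨[.inl x, .inr e], [], by simp⟩))
    exact ⟨.cons e (joins_of_mem h1 h2 hxy) p, by rw [toList, hp]⟩

end Path

end PartialGraph

theorem _root_.List.nodup_of_nodup_filterMap_sum {V : Type*} {E : Type*} {l : List (V ⊕ E)}
    (h1 : (l.filterMap Sum.getLeft?).Nodup) (h2 : (l.filterMap Sum.getRight?).Nodup) :
    l.Nodup := by
  induction l with
  | nil => simp
  | cons a l ih => cases a <;> simp_all [List.filterMap_cons]

/-! ### Translation of proof nets into incidence graphs with cusps -/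

namespace LabeledGraph

variable {Atom : Type w} {V : Type u} {E : Type v} {ρ : LabeledGraph Atom V E}

variable (ρ) in
/-- The `⅋`-vertices, in the incidence graph. -/
def parVertices : Set (V ⊕ E) := {a | ∃ x, a = .inl x ∧ ρ.label x = Rule.par}

open Classical in
variable (ρ) in
/-- The conclusion of a vertex, in the incidence graph. -/
noncomputable def conclusionOf : V ⊕ E → V ⊕ E
  | .inl x => if h : (ρ.conclusions x).Nonempty then .inr h.some else .inl x
  | .inr e => .inr e

variable (ρ) in
/-- The incidence graph of a labeled graph. -/
abbrev incidence : SimpleGraph (V ⊕ E) := ρ.toPartialGraph.incidence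

theorem mem_inc_iff {x : V} {e : E} :
    x ∈ ρ.toPartialGraph.inc e ↔ e ∈ ρ.conclusions x ∨ e ∈ ρ.premises x := Iff.rfl

@[simp] theorem inl_mem_parVertices {x : V} :
    (.inl x : V ⊕ E) ∈ ρ.parVertices ↔ ρ.label x = Rule.par := by
  simp [parVertices]

namespace IsProofStructure

variable (h : ρ.IsProofStructure)
include h

theorem par_constraint {x : V} (hx : ρ.label x = Rule.par) :
    ∃ e f d, e ≠ f ∧ ρ.premises x = {e, f} ∧ ρ.conclusions x = {d} ∧
      ρ.conclusionOf (.inl x) = .inr d := by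
  have := h.vertex x
  unfold VertexConstraint at this
  rw [hx] at this
  obtain ⟨e, f, d, h1, h2, h3, -⟩ := this
  refine ⟨e, f, d, h1, h2, h3, ?_⟩
  have hne : (ρ.conclusions x).Nonempty := by rw [h3]; exact Set.singleton_nonempty d
  simp only [conclusionOf, dif_pos hne]
  exact congrArg _ (h3.subset hne.some_mem)

/-- An edge that is both premise and conclusion of `x` would be a directed loop, against acyclicity.
-/
theorem conclusionOf_ne {x : V} {e : E} (hx : ρ.label x = Rule.par) (he : e ∈ ρ.premises x) :
    (.inr e : V ⊕ E) ≠ ρ.conclusionOf (.inl x) := by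
  obtain ⟨_, _, d, -, -, h3, h4⟩ := h.par_constraint hx
  rw [h4]
  rintro heq
  obtain rfl : e = d := by simpa using heq
  have hc : e ∈ ρ.conclusions x := by rw [h3]; rfl
  exact h.acyclic x (.single ⟨e, hc, he⟩)

theorem eq_conclusionOf {x : V} {e : E} (hx : ρ.label x = Rule.par) (he : e ∈ ρ.conclusions x) :
    (.inr e : V ⊕ E) = ρ.conclusionOf (.inl x) := by
  obtain ⟨_, _, d, -, -, h3, h4⟩ := h.par_constraint hx
  rw [h3, Set.mem_singleton_iff] at he
  rw [h4, he]

end IsProofStructure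

/-- The two neighbours of the first element of a cycle. -/
theorem _root_.ProofNets.SmoothCycle.exists_ends {α : Type*} {G : SimpleGraph α} {P : Set α}
    {c : α → α} {x : α} {l : List α} (h : SmoothCycle G P c x l) :
    ∃ a k b, l = a :: (k ++ [b]) ∧ G.Adj x a ∧ G.Adj x b ∧ a ≠ b := by
  obtain ⟨a, k, b, rfl⟩ : ∃ e k f, l = e :: (k ++ [f]) := by
    have := h.two_le
    cases l with
    | nil => simp at this
    | cons e k =>
      cases k using List.reverseRecOn with
      | nil => simp at this
      | append_singleton k f => exact ⟨e, k, f, rfl⟩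
  refine ⟨a, k, b, rfl, h.adj_head rfl, ?_, ?_⟩
  · have := h.smooth.chain.infix (l₁ := [b, x]) ⟨x :: a :: k, [], by simp⟩
    simp at this
    exact this.symm
  · rintro rfl
    have := (List.nodup_cons.1 h.nodup).2
    simp at this

theorem mem_of_adj {G : PartialGraph V E} {a b : V ⊕ E} {e : E} {z : V}
    (ha : G.incidence.Adj (.inr e) a) (hb : G.incidence.Adj (.inr e) b) (hab : a ≠ b)
    (hz : z ∈ G.inc e) : .inl z = a ∨ .inl z = b := by
  rcases a with x | a
  swap
  · exact absurd ha PartialGraph.not_incidence_inr_inr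
  rcases b with y | b
  swap
  · exact absurd hb PartialGraph.not_incidence_inr_inr
  have := (PartialGraph.joins_of_mem (G := G) (e := e) ha hb (by rintro rfl; exact hab rfl)).2
  rw [this] at hz
  simpa using hz

/-- In a cycle starting at `z`, the edges incident to `z` are the first and the last ones. -/
theorem head_or_last_of_mem {G : PartialGraph V E} {P : Set (V ⊕ E)} {c : V ⊕ E → V ⊕ E} {z : V}
    {l : List (V ⊕ E)} (h : SmoothCycle G.incidence P c (.inl z) l) {e : E}
    (he : .inr e ∈ l) (hz : z ∈ G.inc e) :
    l.head? = some (.inr e) ∨ l.getLast? = some (.inr e) := by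
  obtain ⟨s, t, rfl⟩ := List.append_of_mem he
  cases s using List.reverseRecOn with
  | nil => left; rfl
  | append_singleton s a =>
    cases t with
    | nil => right; simp
    | cons b t =>
      exfalso
      have hch := h.smooth.chain.infix (l₁ := [a, .inr e, b]) ⟨.inl z :: s, t ++ [.inl z], by simp⟩
      simp only [List.isChain_cons_cons, List.isChain_singleton, and_true] at hch
      have hn := h.nodup
      have hab : a ≠ b := by
        rintro rfl
        have := (List.nodup_append.1 (List.nodup_cons.1 hn).2).2.2 a (by simp) a (by simp)
        exact this rfl
      rcases mem_of_adj hch.1.symm hch.2 hab hz with rfl | rfl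
      · simp at hn
      · simp at hn

/-- A cusp-free cycle is switching: if it contained both premises of a ⅋-vertex `z`, it would pass
through `z` between them, which is a cusp. -/
theorem IsProofNet.not_smoothCycle (h : ρ.IsProofNet) (a : V ⊕ E) (l : List (V ⊕ E)) :
    ¬ SmoothCycle ρ.incidence ρ.parVertices ρ.conclusionOf a l := by
  intro hc
  -- Paths start at a vertex, so a cycle starting at an edge is rotated by one step.
  obtain ⟨x, l, hc⟩ : ∃ x l, SmoothCycle ρ.incidence ρ.parVertices ρ.conclusionOf (.inl x) l := by
    rcases a with x | e
    · exact ⟨x, l, hc⟩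
    · obtain ⟨y, k, b, rfl, hy, -⟩ := hc.exists_ends
      rcases y with y | f
      · exact ⟨y, _, hc.rotate⟩
      · exact absurd hy PartialGraph.not_incidence_inr_inr
  obtain ⟨p, hp⟩ := PartialGraph.Path.exists_toList_eq (x := x) (z := x) _ hc.smooth.chain rfl
    (by rw [List.getLast?_append_of_ne_nil _ (by simp)]; rfl)
    (fun a b d hi => ne_of_infix_cycle hc.nodup hc.two_le hi)
  have hedges : p.edges = l.filterMap Sum.getRight? := by
    rw [p.edges_eq, hp]; simp [List.filterMap_cons]
  have hsupp : p.support = x :: (l.filterMap Sum.getLeft? ++ [x]) := by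
    rw [p.support_eq, hp]; simp
  have hinjR : ∀ a a' : V ⊕ E, ∀ b, b ∈ Sum.getRight? a → b ∈ Sum.getRight? a' → a = a' := by
    rintro (a | a) (b | b) d <;> simp +contextual
  have hinjL : ∀ a a' : V ⊕ E, ∀ b, b ∈ Sum.getLeft? a → b ∈ Sum.getLeft? a' → a = a' := by
    rintro (a | a) (b | b) d <;> simp +contextual
  have hn := hc.nodup
  have hn' : (l ++ [Sum.inl x]).Nodup := List.nodup_append_comm.1 (by simpa using hn)
  refine h.2 x p ⟨?_, ?_, ?_, ?_⟩ ?_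
  · intro h0
    have h1 := p.length_toList
    rw [h0, hp] at h1
    simp at h1
  · rw [hedges]
    exact (List.nodup_cons.1 hn).2.filterMap hinjR
  · rw [hsupp]
    have := hn'.filterMap hinjL
    simpa [List.filterMap_append, List.filterMap_cons] using this
  · rw [hsupp]
    have := hn.filterMap hinjL
    rw [← List.cons_append, List.dropLast_concat]
    simpa only [List.filterMap_cons, Sum.getLeft?_inl] using this
  · rintro z e f ⟨hz, hef, hez, hfz⟩ ⟨he, hf⟩
    replace he : .inr e ∈ l := by simpa [hedges] using he
    replace hf : .inr f ∈ l := by simpa [hedges] using hf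
    obtain ⟨k, hk, hmem⟩ := hc.rotate_to (List.mem_cons_of_mem _ he)
    obtain ⟨a, m, b, rfl, ha, hb, hab⟩ := hk.exists_ends
    -- On the cycle, `e` has two distinct neighbours, hence all its endpoints; so `z` is on the
    -- cycle and it can be rotated to start there.
    have hzl : .inl z ∈ (.inl x :: l : List (V ⊕ E)) := by
      rw [← hmem]
      rcases mem_of_adj ha hb hab (mem_inc_iff.2 (Or.inr hez)) with h1 | h1 <;> simp [h1]
    obtain ⟨k, hk, hmem⟩ := hc.rotate_to hzl
    have hmem' : ∀ g, .inr g ∈ l → .inr g ∈ k := fun g hg => by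
      have := (hmem (.inr g)).2 (List.mem_cons_of_mem _ hg)
      simpa using this
    have he' := head_or_last_of_mem hk (hmem' e he) (mem_inc_iff.2 (Or.inr hez))
    have hf' := head_or_last_of_mem hk (hmem' f hf) (mem_inc_iff.2 (Or.inr hfz))
    have h1 := h.1.conclusionOf_ne hz hez
    have h2 := h.1.conclusionOf_ne hz hfz
    have hef' : (.inr e : V ⊕ E) ≠ .inr f := by simpa using hef
    -- Both ends of the rotated cycle are now the premises `e` and `f`, while the closing condition
    -- requires one end to be the conclusion.
    have h3 := hk.closing (by simpa using hz)
    rcases he' with he' | he' <;> rcases hf' with hf' | hf' <;> rcases h3 with h3 | h3 <;>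
      simp_all

/-- The `mem` clause holds because a ⅋-vertex has exactly two premises, which are here the first and
last edges of the cycle. -/
theorem IsProofStructure.properCycle (h : ρ.IsProofStructure) {x : V} {p : ρ.Path x x}
    (hx : ρ.label x = Rule.par) (hp : ρ.IsProperCycle p) :
    ∃ l, ProperCycle ρ.incidence ρ.parVertices ρ.conclusionOf (.inl x) l := by
  obtain ⟨⟨hne, hed, -, hsu⟩, ⟨e, f, he, hf, -, hef, hex, hfx⟩, hturn⟩ := hp
  obtain ⟨l1, hl1⟩ := PartialGraph.Path.head?_edges hf
  obtain ⟨l2, hl2⟩ := PartialGraph.Path.getLast?_edges he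
  obtain ⟨k, hk⟩ : ∃ k, l1 = k ++ [.inr e, .inl x] := by
    rw [hl1] at hl2
    rcases l2 with _ | ⟨a, _ | ⟨b, l2⟩⟩
    · simp at hl2
    -- A path with a single edge is excluded, since its first and last edges would coincide.
    · simp at hl2
      exact absurd hl2.2.1.symm hef
    · simp at hl2
      exact ⟨l2, hl2.2.2⟩
  subst hk
  have hn : (.inl x :: .inr f :: (k ++ [.inr e]) : List (V ⊕ E)).Nodup := by
    apply List.nodup_of_nodup_filterMap_sum
    · rw [p.support_eq, hl1] at hsu
      have : (.inl x :: .inr f :: (k ++ [.inr e, .inl x]) : List (V ⊕ E)) =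
        (.inl x :: .inr f :: (k ++ [.inr e])) ++ [.inl x] := by simp
      rw [this, List.filterMap_append] at hsu
      simpa only [List.filterMap_cons, List.filterMap_nil, Sum.getLeft?_inl,
        List.dropLast_concat] using hsu
    · rw [p.edges_eq, hl1] at hed
      simpa [List.filterMap_append, List.filterMap_cons] using hed
  have hlist : .inl x :: (.inr f :: (k ++ [.inr e])) ++ [.inl x] = p.toList := by
    rw [hl1]; simp
  have hlast : (.inr f :: (k ++ [.inr e]) : List (V ⊕ E)).getLast? = some (.inr e) := by
    rw [← List.cons_append, List.getLast?_append_of_ne_nil _ (by simp)]; rfl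
  refine ⟨.inr f :: (k ++ [.inr e]), ⟨?_, ?_⟩, hn, by simp, ?_, ?_, ?_⟩
  · rw [hlist]; exact p.isChain_toList
  · intro a b d hi hb
    have had := ne_of_infix_cycle hn (by simp) hi
    obtain ⟨y, rfl, hy⟩ := hb
    rw [hlist] at hi
    have hch := p.isChain_toList.infix hi
    simp only [List.isChain_cons_cons, List.isChain_singleton, and_true] at hch
    rcases a with a | g
    · exact absurd hch.1 PartialGraph.not_incidence_inl_inl
    rcases d with d | g'
    · exact absurd hch.2 PartialGraph.not_incidence_inl_inl
    have hcusp := hturn g y g' (PartialGraph.Path.mem_turns hi)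
    rcases hch with ⟨h1, h2⟩
    rcases mem_inc_iff.1 h1 with h1 | h1
    · exact Or.inl (h.eq_conclusionOf hy h1)
    rcases mem_inc_iff.1 h2 with h2 | h2
    · exact Or.inr (h.eq_conclusionOf hy h2)
    exact absurd ⟨hy, by rintro rfl; exact had rfl, h1, h2⟩ hcusp
  · simpa using h.conclusionOf_ne hx hfx
  · rw [hlast]; simpa using h.conclusionOf_ne hx hex
  · intro d hd hdc
    rcases d with d | g
    · exact absurd hd PartialGraph.not_incidence_inl_inl
    rcases mem_inc_iff.1 hd with h1 | h1
    · exact absurd (h.eq_conclusionOf hx h1) hdc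
    · obtain ⟨e', f', _, -, h2, -⟩ := h.par_constraint hx
      rw [h2] at h1 hex hfx
      simp at h1 hex hfx
      rw [hlast]
      simp only [List.head?_cons, Option.some.injEq, Sum.inr.injEq]
      grind

/-- In an almost connected proof net, a switching does not disconnect anything. -/
theorem IsProofNet.reachable_correctnessGraph (h : ρ.IsProofNet)
    (hac : ∀ x, ρ.label x = Rule.par → ∃ p : ρ.Path x x, ρ.IsProperCycle p) (σ : ρ.Switching)
    {a b : V ⊕ E} (hab : ρ.incidence.Reachable a b) :
    (ρ.correctnessGraph σ).toPartialGraph.incidence.Reachable a b := by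
  classical
  have := h.1.finite_vertices
  have := h.1.finite_edges
  have hstep : ∀ a b, ρ.incidence.Adj a b →
      (ρ.correctnessGraph σ).toPartialGraph.incidence.Reachable a b := by
    intro a b hab
    refine reachable_of_removed (P := ρ.parVertices) (c := ρ.conclusionOf)
      (s := fun a => match a with
        | .inl x => if hx : ρ.label x = Rule.par then .inr (σ.removed ⟨x, hx⟩) else .inl x
        | .inr e => .inr e)
      h.not_smoothCycle ?_ ?_ ?_ ?_ hab
    · rintro _ ⟨x, rfl, -⟩ _ ⟨y, rfl, -⟩
      exact PartialGraph.not_incidence_inl_inl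
    · rintro _ ⟨x, rfl, hx⟩
      obtain ⟨p, hp⟩ := hac x hx
      exact h.1.properCycle hx hp
    · rintro _ ⟨x, rfl, hx⟩
      simp only [dif_pos hx]
      exact h.1.conclusionOf_ne hx (σ.removed_mem ⟨x, hx⟩)
    · have key : ∀ x e, ρ.incidence.Adj (.inl x) (.inr e) →
          (∀ hx : ρ.label x = Rule.par, e ≠ σ.removed ⟨x, hx⟩) →
          (ρ.correctnessGraph σ).toPartialGraph.incidence.Adj (.inl x) (.inr e) := by
        intro x e hxe hr
        rcases mem_inc_iff.1 hxe with h1 | h1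
        · exact Or.inl h1
        · refine Or.inr ?_
          -- A removed edge has its own ⅋-vertex as target, so a premise of `x` can only have been
          -- removed at `x`.
          have : e ∉ Set.range σ.removed := by
            rintro ⟨⟨y, hy⟩, rfl⟩
            have h2 : ρ.tgt _ = some y := σ.removed_mem ⟨y, hy⟩
            have h3 : ρ.tgt _ = some x := h1
            obtain rfl : y = x := by simpa using h2.symm.trans h3
            exact hr hy rfl
          simp only [correctnessGraph, if_neg this]
          exact h1
      rintro (x | e) (y | f) hab h1 h2
      · exact absurd hab PartialGraph.not_incidence_inl_inl
      · refine key x f hab fun hx he => h1 (by simpa using hx) ?_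
        simp only [dif_pos hx, he]
      · refine (key y e hab.symm fun hy he => h2 (by simpa using hy) ?_).symm
        simp only [dif_pos hy, he]
      · exact absurd hab PartialGraph.not_incidence_inr_inr
  obtain ⟨p⟩ := hab
  induction p with
  | nil => exact .refl _
  | cons hab p ih => exact (hstep _ _ hab).trans ih

end LabeledGraph

/-! ### Decomposition into connected components -/

namespace LabeledGraph

variable {Atom : Type w} {V : Type u} {E : Type v} {ρ : LabeledGraph Atom V E}
variable {ι : Type*} {κ : V ⊕ E → ι}

/-- The part of a labeled graph on a fiber of a map constant on connected components. -/
def fiber (ρ : LabeledGraph Atom V E) (κ : V ⊕ E → ι)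
    (hκ : ∀ a b, ρ.incidence.Adj a b → κ a = κ b) (i : ι) :
    LabeledGraph Atom {x : V // κ (.inl x) = i} {e : E // κ (.inr e) = i} where
  src e := (ρ.src e.1).pmap Subtype.mk fun x hx => (hκ (.inl x) (.inr e.1) (.inl hx)).trans e.2
  tgt e := (ρ.tgt e.1).pmap Subtype.mk fun x hx => (hκ (.inl x) (.inr e.1) (.inr hx)).trans e.2
  label x := ρ.label x.1
  type e := ρ.type e.1

variable {hκ : ∀ a b, ρ.incidence.Adj a b → κ a = κ b} {i : ι}

theorem fiber_src {e : {e : E // κ (.inr e) = i}} {x : {x : V // κ (.inl x) = i}} :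
    (ρ.fiber κ hκ i).src e = some x ↔ ρ.src e.1 = some x.1 := by
  simp only [fiber, Option.pmap_eq_some_iff]
  exact ⟨fun ⟨a, _, h2, h3⟩ => by rw [h3]; exact h2, fun h => ⟨x.1, x.2, h, rfl⟩⟩

theorem fiber_tgt {e : {e : E // κ (.inr e) = i}} {x : {x : V // κ (.inl x) = i}} :
    (ρ.fiber κ hκ i).tgt e = some x ↔ ρ.tgt e.1 = some x.1 := by
  simp only [fiber, Option.pmap_eq_some_iff]
  exact ⟨fun ⟨a, _, h2, h3⟩ => by rw [h3]; exact h2, fun h => ⟨x.1, x.2, h, rfl⟩⟩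

theorem mem_fiber_inc {e : {e : E // κ (.inr e) = i}} {x : {x : V // κ (.inl x) = i}} :
    x ∈ (ρ.fiber κ hκ i).toPartialGraph.inc e ↔ x.1 ∈ ρ.toPartialGraph.inc e.1 :=
  or_congr fiber_src fiber_tgt

theorem mem_fiber_premises {e : {e : E // κ (.inr e) = i}} {x : {x : V // κ (.inl x) = i}} :
    e ∈ (ρ.fiber κ hκ i).premises x ↔ e.1 ∈ ρ.premises x.1 := fiber_tgt

theorem mem_fiber_conclusions {e : {e : E // κ (.inr e) = i}} {x : {x : V // κ (.inl x) = i}} :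
    e ∈ (ρ.fiber κ hκ i).conclusions x ↔ e.1 ∈ ρ.conclusions x.1 := fiber_src

theorem mem_fiber_of_adj (hκ : ∀ a b, ρ.incidence.Adj a b → κ a = κ b)
    {x : {x : V // κ (.inl x) = i}} {e : E}
    (h : e ∈ ρ.conclusions x.1 ∨ e ∈ ρ.premises x.1) : κ (.inr e) = i :=
  (hκ (.inl x.1) (.inr e) h).symm.trans x.2

/-- `κ` is constant along incidences, so each vertex keeps all its premises and conclusions in its
fiber, and no endpoint becomes undefined. -/
theorem IsProofStructure.fiber (h : ρ.IsProofStructure)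
    (hκ : ∀ a b, ρ.incidence.Adj a b → κ a = κ b) (i : ι) :
    (ρ.fiber κ hκ i).IsProofStructure where
  finite_vertices := have := h.finite_vertices; inferInstance
  finite_edges := have := h.finite_edges; inferInstance
  acyclic x hx := h.acyclic x.1 (hx.lift Subtype.val fun _ _ ⟨e, he, he'⟩ =>
    ⟨e.1, fiber_src.1 he, fiber_tgt.1 he'⟩)
  localized e := h.localized e.1
  initial_disjoint e f he hf hef := by
    have key : ∀ e, (ρ.fiber κ hκ i).IsInitial e → ρ.IsInitial e.1 := by
      rintro e (he | ⟨x, hx, hl⟩)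
      · left
        simpa [LabeledGraph.fiber] using he
      · exact Or.inr ⟨x.1, fiber_src.1 hx, hl⟩
    exact h.initial_disjoint e.1 f.1 (key e he) (key f hf) fun h => hef (Subtype.ext h)
  vertex x := by
    have hx := h.vertex x.1
    have hl : (ρ.fiber κ hκ i).label x = ρ.label x.1 := rfl
    unfold VertexConstraint at hx ⊢
    rw [hl]
    cases hlab : ρ.label x.1 <;> rw [hlab] at hx <;> simp only at hx ⊢
    · obtain ⟨e, f, hef, hp, hc, ht⟩ := hx
      refine ⟨⟨e, mem_fiber_of_adj hκ (x := x) (.inl (by simp [hc]))⟩,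
        ⟨f, mem_fiber_of_adj hκ (x := x) (.inl (by simp [hc]))⟩, by simpa using hef, ?_, ?_, ht⟩
      · ext g; exact mem_fiber_premises.trans ((Set.ext_iff.1 hp g.1).trans (by simp))
      · ext g; exact mem_fiber_conclusions.trans ((Set.ext_iff.1 hc g.1).trans (by simp [Subtype.ext_iff]))
    · obtain ⟨e, f, hef, hp, hc, ht⟩ := hx
      refine ⟨⟨e, mem_fiber_of_adj hκ (x := x) (.inr (by simp [hp]))⟩,
        ⟨f, mem_fiber_of_adj hκ (x := x) (.inr (by simp [hp]))⟩, by simpa using hef, ?_, ?_, ht⟩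
      · ext g; exact mem_fiber_premises.trans ((Set.ext_iff.1 hp g.1).trans (by simp [Subtype.ext_iff]))
      · ext g; exact mem_fiber_conclusions.trans ((Set.ext_iff.1 hc g.1).trans (by simp))
    all_goals
      obtain ⟨e, f, d, hef, hp, hc, ht⟩ := hx
      refine ⟨⟨e, mem_fiber_of_adj hκ (x := x) (.inr (by simp [hp]))⟩,
        ⟨f, mem_fiber_of_adj hκ (x := x) (.inr (by simp [hp]))⟩,
        ⟨d, mem_fiber_of_adj hκ (x := x) (.inl (by simp [hc]))⟩, by simpa using hef, ?_, ?_, ht⟩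
      · ext g; exact mem_fiber_premises.trans ((Set.ext_iff.1 hp g.1).trans (by simp [Subtype.ext_iff]))
      · ext g; exact mem_fiber_conclusions.trans ((Set.ext_iff.1 hc g.1).trans (by simp [Subtype.ext_iff]))

theorem exists_path_of_fiber {x y : {x : V // κ (.inl x) = i}}
    (p : (ρ.fiber κ hκ i).Path x y) :
    ∃ q : ρ.Path x.1 y.1, q.edges = p.edges.map Subtype.val ∧
      q.support = p.support.map Subtype.val := by
  induction p with
  | nil x => exact ⟨.nil x.1, rfl, rfl⟩
  | @cons x y z e h p ih =>
    obtain ⟨q, hq1, hq2⟩ := ih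
    have hx : x.1 ∈ ρ.toPartialGraph.inc e.1 :=
      mem_fiber_inc.1 (show x ∈ (ρ.fiber κ hκ i).toPartialGraph.inc e by simp [h.2])
    have hy : y.1 ∈ ρ.toPartialGraph.inc e.1 :=
      mem_fiber_inc.1 (show y ∈ (ρ.fiber κ hκ i).toPartialGraph.inc e by simp [h.2])
    exact ⟨.cons e.1 (PartialGraph.joins_of_mem hx hy fun h' => h.1 (Subtype.ext h')) q,
      by simp [PartialGraph.Path.edges, hq1], by simp [PartialGraph.Path.support, hq2]⟩

theorem IsProofNet.fiber (h : ρ.IsProofNet) (hκ : ∀ a b, ρ.incidence.Adj a b → κ a = κ b)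
    (i : ι) : (ρ.fiber κ hκ i).IsProofNet := by
  refine ⟨h.1.fiber hκ i, fun x p hp hs => ?_⟩
  obtain ⟨q, hq1, hq2⟩ := exists_path_of_fiber p
  obtain ⟨h1, h2, h3, h4⟩ := hp
  refine h.2 x.1 q ⟨fun h0 => h1 (List.map_eq_nil_iff.1 (hq1 ▸ h0)), ?_, ?_, ?_⟩ ?_
  · rw [hq1]; exact h2.map Subtype.val_injective
  · rw [hq2, ← List.map_tail]; exact h3.map Subtype.val_injective
  · rw [hq2, ← List.map_dropLast]; exact h4.map Subtype.val_injective
  · rintro z e f ⟨hz, hef, hez, hfz⟩ ⟨he, hf⟩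
    rw [hq1, List.mem_map] at he hf
    obtain ⟨e, he, rfl⟩ := he
    obtain ⟨f, hf, rfl⟩ := hf
    have hzi : κ (.inl z) = i := (hκ (.inl z) (.inr e.1) (.inr hez)).trans e.2
    exact hs ⟨z, hzi⟩ e f ⟨hz, fun h => hef (congrArg _ h), mem_fiber_premises.2 hez,
      mem_fiber_premises.2 hfz⟩ ⟨he, hf⟩

theorem correctnessGraph_adj {σ : ρ.Switching} {a b : V ⊕ E}
    (h : (ρ.correctnessGraph σ).toPartialGraph.incidence.Adj a b) : ρ.incidence.Adj a b := by
  have key : ∀ x e, x ∈ (ρ.correctnessGraph σ).toPartialGraph.inc e →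
      x ∈ ρ.toPartialGraph.inc e := by
    rintro x e (h | h)
    · exact Or.inl h
    · right
      simp only [correctnessGraph] at h
      split_ifs at h
      exact h
  rcases a with x | e <;> rcases b with y | f
  · exact absurd h PartialGraph.not_incidence_inl_inl
  · exact key _ _ h
  · exact key _ _ h
  · exact absurd h PartialGraph.not_incidence_inr_inr

/-- A switching of the fiber extends to the whole net, where it disconnects nothing. Walks in the
resulting correctness graph that start in the fiber stay in it, since `κ` is constant along them. -/
theorem IsProofNet.isDRConnected_fiber (h : ρ.IsProofNet)
    (hac : ∀ x, ρ.label x = Rule.par → ∃ p : ρ.Path x x, ρ.IsProperCycle p)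
    (hκ : ∀ a b, ρ.incidence.Adj a b → κ a = κ b)
    (hκ' : ∀ a b, κ a = κ b → ρ.incidence.Reachable a b) {i : ι} (hi : ∃ a, κ a = i) :
    (ρ.fiber κ hκ i).IsDRConnected := by
  classical
  intro σ
  have hprem : ∀ x, ρ.label x = Rule.par → (ρ.premises x).Nonempty := fun x hx => by
    obtain ⟨e, f, _, -, hp, -⟩ := h.1.par_constraint hx
    exact ⟨e, by simp [hp]⟩
  -- Outside the fiber any premise will do.
  let τ : ρ.Switching :=
    { removed := fun x => if hx : κ (.inl x.1) = i then (σ.removed ⟨⟨x.1, hx⟩, x.2⟩).1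
        else (hprem x.1 x.2).some
      removed_mem := fun x => by
        split_ifs with hx
        · exact mem_fiber_premises.1 (σ.removed_mem ⟨⟨x.1, hx⟩, x.2⟩)
        · exact (hprem x.1 x.2).some_mem }
  -- This inclusion suffices: an edge kept by `τ` is kept by `σ`.
  have hτ : ∀ e, e ∈ Set.range σ.removed → e.1 ∈ Set.range τ.removed := by
    rintro _ ⟨x, rfl⟩
    exact ⟨⟨x.1.1, x.2⟩, dif_pos x.1.2⟩
  let emb : {x : V // κ (.inl x) = i} ⊕ {e : E // κ (.inr e) = i} → V ⊕ E :=
    Sum.map Subtype.val Subtype.val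
  have hemb : Function.Injective emb := Subtype.val_injective.sumMap Subtype.val_injective
  have hκemb : ∀ a, κ (emb a) = i := by
    rintro (x | e)
    · exact x.2
    · exact e.2
  have hsurj : ∀ a, κ a = i → ∃ a', emb a' = a := by
    rintro (x | e) ha
    · exact ⟨.inl ⟨x, ha⟩, rfl⟩
    · exact ⟨.inr ⟨e, ha⟩, rfl⟩
  have hinc : ∀ (x : {x : V // κ (.inl x) = i}) (e : {e : E // κ (.inr e) = i}),
      x.1 ∈ (ρ.correctnessGraph τ).toPartialGraph.inc e.1 →
      x ∈ ((ρ.fiber κ hκ i).correctnessGraph σ).toPartialGraph.inc e := by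
    rintro x e (hx | hx)
    · exact Or.inl (fiber_src (hκ := hκ).2 hx)
    · right
      simp only [correctnessGraph] at hx ⊢
      split_ifs at hx with he
      rw [if_neg fun he' => he (hτ e he')]
      exact fiber_tgt.2 hx
  have hadj : ∀ a b, (ρ.correctnessGraph τ).toPartialGraph.incidence.Adj (emb a) (emb b) →
      ((ρ.fiber κ hκ i).correctnessGraph σ).toPartialGraph.incidence.Adj a b := by
    rintro (x | e) (y | f) hab
    · exact absurd hab PartialGraph.not_incidence_inl_inl
    · exact hinc x f hab
    · exact hinc y e hab
    · exact absurd hab PartialGraph.not_incidence_inr_inr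
  have hreach : ∀ a b, (ρ.correctnessGraph τ).toPartialGraph.incidence.Reachable a b →
      ∀ a' b', emb a' = a → emb b' = b →
      ((ρ.fiber κ hκ i).correctnessGraph σ).toPartialGraph.incidence.Reachable a' b' := by
    rintro a b ⟨p⟩
    induction p with
    | nil =>
      intro a' b' ha hb
      rw [hemb (ha.trans hb.symm)]
    | @cons a d b had p ih =>
      intro a' b' ha hb
      obtain ⟨d', rfl⟩ := hsurj d
        ((hκ _ _ (correctnessGraph_adj had)).symm.trans (ha ▸ hκemb a'))
      subst ha
      exact (hadj _ _ had).reachable.trans (ih d' b' rfl hb)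
  rw [PartialGraph.numComponents_eq_one_iff]
  obtain ⟨a, ha⟩ := hi
  refine ⟨⟨(hsurj a ha).choose⟩, fun a b => hreach _ _ ?_ a b rfl rfl⟩
  exact h.reachable_correctnessGraph hac τ (hκ' _ _ ((hκemb a).trans (hκemb b).symm))

/-- A labeled graph is the disjoint union of its parts on the fibers of a map constant on connected
components. -/
def fiberIso (ρ : LabeledGraph Atom V E) {n : ℕ} (κ : V ⊕ E → Fin n)
    (hκ : ∀ a b, ρ.incidence.Adj a b → κ a = κ b) :
    ρ.Iso (disjointUnion fun i => ρ.fiber κ hκ i) :=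
  have key : ∀ (i : Fin n) (o : Option V) (h : ∀ x ∈ o, κ (.inl x) = i),
      (o.pmap (Subtype.mk (p := fun x => κ (.inl x) = i)) h).map
        (Sigma.mk (β := fun i => {x : V // κ (.inl x) = i}) i) =
        o.map (Equiv.sigmaFiberEquiv fun x : V => κ (.inl x)).symm := by
    rintro i (_ | x) h
    · rfl
    · obtain rfl := h x rfl
      rfl
  { vertexEquiv := (Equiv.sigmaFiberEquiv fun x : V => κ (.inl x)).symm
    edgeEquiv := (Equiv.sigmaFiberEquiv fun e : E => κ (.inr e)).symm
    src_eq := fun e => key _ _ _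
    tgt_eq := fun e => key _ _ _
    label_eq := fun _ => rfl
    type_eq := fun _ => rfl }

end LabeledGraph

end ProofNets

theorem mainTheorem8 {Atom : Type w} {V : Type u} {E : Type v}
    (ρ : ProofNets.LabeledGraph Atom V E) (hnet : ρ.IsProofNet) (hac : ρ.IsAlmostConnected) :
    ∃ (n : ℕ) (V' : Fin n → Type u) (E' : Fin n → Type v)
      (τ : ∀ i, ProofNets.LabeledGraph Atom (V' i) (E' i)),
      0 < n ∧ (∀ i, (τ i).IsProofNet ∧ (τ i).IsDRConnected) ∧
        Nonempty (ρ.Iso (ProofNets.disjointUnion τ)) := by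
  have := hnet.1.finite_vertices
  have := hnet.1.finite_edges
  obtain ⟨⟨a⟩, hpar⟩ := hac
  let e := Finite.equivFin ρ.incidence.ConnectedComponent
  let κ : V ⊕ E → Fin (Nat.card ρ.incidence.ConnectedComponent) :=
    fun a => e (ρ.incidence.connectedComponentMk a)
  have hκ : ∀ a b, ρ.incidence.Adj a b → κ a = κ b := fun a b h =>
    congrArg e (SimpleGraph.ConnectedComponent.sound h.reachable)
  -- The family is indexed by the connected components, and the given element `a` makes their number
  -- positive.
  refine ⟨_, _, _, fun i => ρ.fiber κ hκ i, (κ a).pos, fun i => ⟨hnet.fiber hκ i, ?_⟩,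
    ⟨ρ.fiberIso κ hκ⟩⟩
  refine hnet.isDRConnected_fiber hpar hκ
    (fun a b h => SimpleGraph.ConnectedComponent.exact (e.injective h)) ?_
  obtain ⟨c, rfl⟩ := e.surjective i
  induction c using SimpleGraph.ConnectedComponent.ind with
  | h b => exact ⟨b, rfl⟩
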